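/- Let $M$ be a countable first-order structure. For $X\subseteq M$ let ${\rm Aut}(M/X)$ be the group of automorphisms of $M$ fixing every element of $X$, and let ${\rm orb}(b/X)$ be the ${\rm Aut}(M/X)$-orbit of $b\in M$. Let $d$ be a non-zero integer-valued dimension function on $M$, i.e. $d$ is a function from the finite subsets of $M$ to $\mathbb Z$, not identically zero, such that $d(\emptyset)=0$ and, for all finite $X,Y\subseteq M$ and $g\in{\rm Aut}(M)$, $$d(gX)=d(X),\qquad 0\le d(X)\le d(X\cup Y)\le d(X)+d(Y)-d(X\cap Y).$$ For finite $X$ and arbitrary $Z,S\subseteq M$ put $d(X/Z)=\min\{d(X\cup Y)-d(Y): Y\subseteq Z \text{ finite}\}$, $d(S/Z)=\max\{d(X/Z): X\subseteq S\text{ finite}\}$ when this maximum exists, and ${\rm cl}^d(Z)=\{a\in M: d(\{a\}/Z)=0\}$. Let $\mathcal X=\{{\rm cl}^d(X): X\subseteq M\text{ finite}\}$, and for $A,B,C\in\mathcal X$ write $A\perp^d_B C$ if $d(A/B\cup C)=d(A/B)$. Assume: (a) (${\rm cl}^d$ subsumes definable closure) if $X\subseteq M$ is finite and $a\in M$ is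 fixed by ${\rm Aut}(M/{\rm cl}^d(X))$, then $a\in{\rm cl}^d(X)$; (b) (Existence) for all $A,B,C\in\mathcal X$ there is $g\in{\rm Aut}(M/B)$ with $gA\perp^d_B C$; (c) (Stationarity) if $A_1,A_2,B,C\in\mathcal X$, $B\subseteq A_i$ and $A_i\perp^d_B C$ for $i=1,2$, and $h:A_1\to A_2$ is a bijection which is the identity on $B$ and extends to an automorphism of $M$, then some automorphism of $M$ extends $h\cup{\rm id}_C$. Say that $b\in M$ is basic over $A\in\mathcal X$ if $b\notin A$ and, whenever $A\subseteq C\in\mathcal X$ and $d(\{b\}/C)<d(\{b\}/A)$, then $b\in C$. Suppose that there are $A\in\mathcal X$ and an element $b\in M$ basic over $A$ such that $D={\rm orb}(b/A)$ satisfies ${\rm cl}^d(A\cup D)=M$. Let $G={\rm Aut}(M/{\rm cl}^d(\emptyset))$ and let $g\in G$ be not ${\rm cl}^d$-bounded, i.e. there is no $E\in\mathcal X$ such that $gB=B$ for all $B\in\mathcal X$ with $E\subseteq B$. Then every element of $G$ is a product of $96$ elements, each of which is a conjugate in $G$ of $g$ or of $g^{-1}$. -/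

import Mathlib

/-!
Every `s ∈ G` is determined by its restrictions to the closures of finite sets, and `G` is a
completely metrizable group, `M` being countable, in which the pointwise stabilisers of these
closures form a basis of neighbourhoods of `1`.

For every finite set `E`, a `g` which is not bounded sends some element `c` of the basic orbit
outside the closure of `E ∪ {c}`. As the dimension of a set of elements of the orbit only counts
independent elements, and as the orbit generates `M`, it follows that `g` moves almost maximally:
every finite set has a conjugate over `B` which is independent over `B` from its image under `g`.

Given this and Stationarity, a conjugate of `g` can be chosen to carry a generic copy of a finite
set to another one. Starting from two ends and meeting in a generic copy in the middle, four
conjugates `(h i)⁻¹ * g * h i` realise a prescribed map on any finite set, with the `h i` close to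
`1`. Hence the map `Φ` taking `h` to the product of these four conjugates sends nonempty open sets
to somewhere dense sets, and its range is dense because conjugation is topologically transitive. A
Baire category argument shows that `Φ` and `f * Φ` take a common value, `Φ h = f * Φ k`, which makes
`f` a product of eight conjugates of `g` and `g⁻¹`. Pairs `g * g⁻¹` bring the number of factors
to `96`.
-/

namespace DimIndep

open scoped FirstOrder

universe u v w

noncomputable section

open scoped Classical

/-- `Aut(M)`: the automorphisms of a first-order structure form a group under composition. -/
instance autGroup (L : FirstOrder.Language.{u, v}) (M : Type w) [L.Structure M] : Group (M ≃[L] M) where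
  mul f g := f.comp g
  one := FirstOrder.Language.Equiv.refl L M
  inv f := f.symm
  mul_assoc _ _ _ := rfl
  one_mul _ := rfl
  mul_one _ := rfl
  inv_mul_cancel f := FirstOrder.Language.Equiv.symm_comp_self f

/-- `Aut(M/X)`: the automorphisms fixing every element of `X`. -/
def autFix (L : FirstOrder.Language.{u, v}) {M : Type w} [L.Structure M] (X : Set M) :
    Subgroup (M ≃[L] M) where
  carrier := {f | ∀ x ∈ X, f x = x}
  mul_mem' {f g} hf hg x hx := by
    change f (g x) = x
    rw [hg x hx, hf x hx]
  one_mem' _ _ := rfl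
  inv_mem' {f} hf x hx := by
    change f.symm x = x
    conv_lhs => rw [← hf x hx]
    exact f.symm_apply_apply x

/-- `orb(b/X)`: the orbit of `b` under `Aut(M/X)`. -/
def orb (L : FirstOrder.Language.{u, v}) {M : Type w} [L.Structure M] (b : M) (X : Set M) : Set M :=
  {c | ∃ f ∈ autFix L X, f b = c}

/-- Integer-valued dimension functions on `M`, normalised by `d(∅) = 0`. -/
structure IsDimensionFunction (L : FirstOrder.Language.{u, v}) {M : Type w} [L.Structure M]
    (d : Finset M → ℤ) : Prop where
  invariant : ∀ (g : M ≃[L] M) (X : Finset M), d (X.image g) = d X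
  nonneg : ∀ X : Finset M, 0 ≤ d X
  mono : ∀ X Y : Finset M, d X ≤ d (X ∪ Y)
  submodular : ∀ X Y : Finset M, d (X ∪ Y) ≤ d X + d Y - d (X ∩ Y)
  empty : d ∅ = 0

section

variable {M : Type w}

/-- `d(X/Z) = min {d(X ∪ Y) - d(Y) : Y ⊆ Z finite}` for `X` finite and `Z` arbitrary. The set of
integers is nonempty and bounded below by `0` when `d` is a dimension function, so that the
infimum is a minimum. -/
def relDim (d : Finset M → ℤ) (X : Finset M) (Z : Set M) : ℤ :=
  sInf {n : ℤ | ∃ Y : Finset M, (Y : Set M) ⊆ Z ∧ n = d (X ∪ Y) - d Y}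

/-- `d(A/Z) = max {d(X/Z) : X ⊆ A finite}` for `A` arbitrary. It is only used for `A` the
`d`-closure of a finite set, where the set of integers is nonempty and bounded above. -/
def setDim (d : Finset M → ℤ) (A Z : Set M) : ℤ :=
  sSup {n : ℤ | ∃ X : Finset M, (X : Set M) ⊆ A ∧ n = relDim d X Z}

/-- The `d`-closure `cl^d(Z)`. -/
def dClosure (d : Finset M → ℤ) (Z : Set M) : Set M :=
  {a | relDim d {a} Z = 0}

/-- The collection `𝒳` of `d`-closures of finite sets. -/
def closures (d : Finset M → ℤ) : Set (Set M) :=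
  {A | ∃ X : Finset M, A = dClosure d (X : Set M)}

/-- `d`-independence of `A` and `C` over `B`. -/
def Indep (d : Finset M → ℤ) (A B C : Set M) : Prop :=
  setDim d A (B ∪ C) = setDim d A B

/-- `b` is basic over `A`. -/
def IsBasic (d : Finset M → ℤ) (b : M) (A : Set M) : Prop :=
  b ∉ A ∧ ∀ C ∈ closures d, A ⊆ C → relDim d {b} C < relDim d {b} A → b ∈ C

end

section

variable (L : FirstOrder.Language.{u, v}) {M : Type w} [L.Structure M]

/-- `cl^d` subsumes definable closure. -/
def SubsumesDefinableClosure (d : Finset M → ℤ) : Prop :=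
  ∀ (X : Finset M) (a : M),
    (∀ f ∈ autFix L (dClosure d (X : Set M)), f a = a) → a ∈ dClosure d (X : Set M)

/-- The Existence axiom for `d`-independence. -/
def Existence (d : Finset M → ℤ) : Prop :=
  ∀ A ∈ closures d, ∀ B ∈ closures d, ∀ C ∈ closures d,
    ∃ g ∈ autFix L B, Indep d (g '' A) B C

/-- The Stationarity axiom for `d`-independence. A partial automorphism `A₁ → A₂` is the
restriction to `A₁` of an automorphism `h` with `h '' A₁ = A₂`. -/
def Stationary (d : Finset M → ℤ) : Prop :=
  ∀ A₁ ∈ closures d, ∀ A₂ ∈ closures d, ∀ B ∈ closures d, ∀ C ∈ closures d,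
    B ⊆ A₁ → B ⊆ A₂ → Indep d A₁ B C → Indep d A₂ B C →
    ∀ h : M ≃[L] M, h '' A₁ = A₂ → (∀ b ∈ B, h b = b) →
      ∃ k : M ≃[L] M, (∀ a ∈ A₁, k a = h a) ∧ ∀ c ∈ C, k c = c

/-- The standing assumption on `d`: a non-zero dimension function whose closure subsumes definable
closure and whose independence relation satisfies Existence. -/
structure StandingAssumption (d : Finset M → ℤ) : Prop where
  isDimensionFunction : IsDimensionFunction L d
  nonzero : ∃ X : Finset M, d X ≠ 0
  subsumes : SubsumesDefinableClosure L d
  existence : Existence L d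

/-- `D` is a basic `Aut(M/A)`-orbit. -/
def IsBasicOrbit (d : Finset M → ℤ) (D A : Set M) : Prop :=
  ∃ b : M, IsBasic d b A ∧ D = orb L b A

variable {L}

/-- `g` is `cl^d`-bounded: it stabilises setwise every member of `𝒳` containing some fixed
`E ∈ 𝒳`. -/
def IsClBounded (d : Finset M → ℤ) (g : M ≃[L] M) : Prop :=
  ∃ E ∈ closures d, ∀ B ∈ closures d, E ⊆ B → g '' B = B

end

end

end DimIndep

namespace DimIndep

open scoped Classical FirstOrder Pointwise Topology

/-! ### Closures and independence of finite sets -/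

/-- Monotone submodular integer-valued functions on finite sets: the part of the notion of a
dimension function that does not mention automorphisms. -/
structure IsMonoSubmodular {M : Type*} (d : Finset M → ℤ) : Prop where
  mono : Monotone d
  submod : ∀ X Y : Finset M, d (X ∪ Y) + d (X ∩ Y) ≤ d X + d Y

/-- The `d`-closure of a finite set; the members of `𝒳` are the sets `cl d X`. -/
abbrev cl {M : Type*} (d : Finset M → ℤ) (X : Finset M) : Set M := dClosure d (X : Set M)

/-- Independence of the finite sets `A` and `C` over the finite set `B`, that is
`d(A/B ∪ C) = d(A/B)`, written without subtraction. -/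
def FinIndep {M : Type*} (d : Finset M → ℤ) (A B C : Finset M) : Prop :=
  d (A ∪ B ∪ C) + d B = d (A ∪ B) + d (B ∪ C)

section Closure

variable {M : Type*} {d : Finset M → ℤ}

namespace IsMonoSubmodular

theorem add_le_add_of_subset (hd : IsMonoSubmodular d) {U Z X Y : Finset M} (hU : U ⊆ X ∪ Y)
    (hX : Z ⊆ X) (hY : Z ⊆ Y) : d U + d Z ≤ d X + d Y :=
  (add_le_add (hd.mono hU) (hd.mono (Finset.subset_inter hX hY))).trans (hd.submod X Y)

theorem relDim_eq_of_forall (hd : IsMonoSubmodular d) (X : Finset M) {B : Finset M} {Z : Set M}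
    (hB : (B : Set M) ⊆ Z) (hZ : ∀ Y : Finset M, (Y : Set M) ⊆ Z → d (B ∪ Y) = d B) :
    relDim d X Z = d (X ∪ B) - d B := by
  refine IsLeast.csInf_eq ⟨⟨B, hB, rfl⟩, ?_⟩
  rintro _ ⟨Y, hY, rfl⟩
  have := hd.add_le_add_of_subset (U := X ∪ B) (Z := Y) (X := X ∪ Y) (Y := B ∪ Y)
    (by grind) (by grind) (by grind)
  linarith [hZ Y hY]

theorem relDim_coe (hd : IsMonoSubmodular d) (X B : Finset M) :
    relDim d X (B : Set M) = d (X ∪ B) - d B :=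
  hd.relDim_eq_of_forall X subset_rfl fun Y hY => by
    rw [Finset.union_eq_left.2 (by exact_mod_cast hY)]

theorem mem_cl (hd : IsMonoSubmodular d) {X : Finset M} {a : M} :
    a ∈ cl d X ↔ d (insert a X) = d X := by
  change relDim d {a} (X : Set M) = 0 ↔ _
  rw [hd.relDim_coe, sub_eq_zero, Finset.insert_eq]

theorem coe_subset_cl (hd : IsMonoSubmodular d) {X Y : Finset M} :
    (Y : Set M) ⊆ cl d X ↔ d (X ∪ Y) = d X := by
  constructor
  · induction Y using Finset.induction_on with
    | empty => simp
    | insert y Y _ ih =>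
      intro h
      rw [Finset.coe_insert, Set.insert_subset_iff, hd.mem_cl] at h
      have hsub := hd.add_le_add_of_subset (U := X ∪ insert y Y) (Z := X) (X := insert y X)
        (Y := X ∪ Y) (by grind) (by grind) (by grind)
      have hmono := hd.mono (show X ⊆ X ∪ insert y Y from Finset.subset_union_left)
      linarith [h.1, ih h.2]
  · intro h y hy
    refine hd.mem_cl.2 (le_antisymm (h ▸ hd.mono ?_) (hd.mono (Finset.subset_insert y X)))
    exact Finset.insert_subset (Finset.mem_union_right _ hy) Finset.subset_union_left

theorem subset_cl (hd : IsMonoSubmodular d) (X : Finset M) : (X : Set M) ⊆ cl d X :=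
  hd.coe_subset_cl.2 (by rw [Finset.union_self])

theorem cl_subset_cl_iff (hd : IsMonoSubmodular d) {X Y : Finset M} :
    cl d Y ⊆ cl d X ↔ (Y : Set M) ⊆ cl d X := by
  refine ⟨(hd.subset_cl Y).trans, fun h a ha => ?_⟩
  rw [hd.mem_cl] at ha ⊢
  rw [hd.coe_subset_cl] at h
  have hsub := hd.add_le_add_of_subset (U := insert a X) (Z := Y) (X := X ∪ Y) (Y := insert a Y)
    (by grind) (by grind) (by grind)
  exact le_antisymm (by linarith) (hd.mono (Finset.subset_insert a X))

theorem cl_mono (hd : IsMonoSubmodular d) {X Y : Finset M} (h : X ⊆ Y) : cl d X ⊆ cl d Y :=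
  hd.cl_subset_cl_iff.2 ((Finset.coe_subset.2 h).trans (hd.subset_cl Y))

theorem relDim_eq (hd : IsMonoSubmodular d) (X : Finset M) {B : Finset M} {Z : Set M}
    (hB : (B : Set M) ⊆ Z) (hZ : Z ⊆ cl d B) : relDim d X Z = d (X ∪ B) - d B :=
  hd.relDim_eq_of_forall X hB fun _ hY => hd.coe_subset_cl.1 (hY.trans hZ)

theorem setDim_eq (hd : IsMonoSubmodular d) (A : Finset M) {B : Finset M} {Z : Set M}
    (hB : (B : Set M) ⊆ Z) (hZ : Z ⊆ cl d B) : setDim d (cl d A) Z = d (A ∪ B) - d B := by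
  refine IsGreatest.csSup_eq ⟨⟨A, hd.subset_cl A, (hd.relDim_eq A hB hZ).symm⟩, ?_⟩
  rintro _ ⟨X, hX, rfl⟩
  have hXAB : d (A ∪ B ∪ X) = d (A ∪ B) :=
    hd.coe_subset_cl.1 (hX.trans (hd.cl_mono Finset.subset_union_left))
  rw [hd.relDim_eq X hB hZ]
  linarith [hd.mono (show X ∪ B ⊆ A ∪ B ∪ X by grind)]

theorem mem_dClosure_iff (hd : IsMonoSubmodular d) {Z : Set M} {a : M} :
    a ∈ dClosure d Z ↔ ∃ Y : Finset M, (Y : Set M) ⊆ Z ∧ a ∈ cl d Y := by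
  set S : Set ℤ := {n | ∃ Y : Finset M, (Y : Set M) ⊆ Z ∧ n = d ({a} ∪ Y) - d Y}
  have hbdd : ∀ n ∈ S, 0 ≤ n := by
    rintro _ ⟨Y, -, rfl⟩
    exact sub_nonneg.2 (hd.mono Finset.subset_union_right)
  have hmem (Y : Finset M) : a ∈ cl d Y ↔ 0 = d ({a} ∪ Y) - d Y := by
    rw [hd.mem_cl, Finset.insert_eq, eq_comm (a := (0 : ℤ)), sub_eq_zero]
  simp only [hmem]
  change sInf S = 0 ↔ 0 ∈ S
  constructor
  · intro h
    rw [← h]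
    exact Int.csInf_mem ⟨_, ∅, by simp, rfl⟩ ⟨0, hbdd⟩
  · exact fun h => IsLeast.csInf_eq ⟨h, hbdd⟩

theorem indep_cl_iff (hd : IsMonoSubmodular d) {A B C : Finset M} :
    Indep d (cl d A) (cl d B) (cl d C) ↔ FinIndep d A B C := by
  have hBC : ((B ∪ C : Finset M) : Set M) ⊆ cl d B ∪ cl d C := by
    rw [Finset.coe_union]
    exact Set.union_subset_union (hd.subset_cl B) (hd.subset_cl C)
  have hcl : cl d B ∪ cl d C ⊆ cl d (B ∪ C) :=
    Set.union_subset (hd.cl_mono Finset.subset_union_left) (hd.cl_mono Finset.subset_union_right)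
  rw [Indep, FinIndep, hd.setDim_eq A hBC hcl, hd.setDim_eq A (hd.subset_cl B) subset_rfl,
    Finset.union_assoc, sub_eq_sub_iff_add_eq_add]

theorem finIndep_of_le (hd : IsMonoSubmodular d) {A B C : Finset M}
    (h : d (A ∪ B) + d (B ∪ C) ≤ d (A ∪ B ∪ C) + d B) : FinIndep d A B C :=
  le_antisymm (hd.add_le_add_of_subset (by grind) (by grind) (by grind)) h

end IsMonoSubmodular

namespace FinIndep

theorem symm {A B C : Finset M} (h : FinIndep d A B C) : FinIndep d C B A := by
  unfold FinIndep at *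
  rw [show C ∪ B ∪ A = A ∪ B ∪ C by grind, Finset.union_comm C B, Finset.union_comm B A]
  linarith

theorem right (hd : IsMonoSubmodular d) {A B C C' : Finset M} (h : FinIndep d A B C)
    (hC : (C' : Set M) ⊆ cl d (B ∪ C)) : FinIndep d A B C' := by
  apply hd.finIndep_of_le
  have := hd.add_le_add_of_subset (U := A ∪ B ∪ C) (Z := B ∪ C') (X := A ∪ B ∪ C')
    (Y := B ∪ C ∪ C') (by grind) (by grind) (by grind)
  linarith [h.le, h.ge, hd.coe_subset_cl.1 hC]

theorem mono_cl (hd : IsMonoSubmodular d) {A A' B C C' : Finset M} (h : FinIndep d A B C)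
    (hA : (A' : Set M) ⊆ cl d (B ∪ A)) (hC : (C' : Set M) ⊆ cl d (B ∪ C)) : FinIndep d A' B C' :=
  ((h.right hd hC).symm.right hd hA).symm

theorem mono (hd : IsMonoSubmodular d) {A A' B C C' : Finset M} (h : FinIndep d A B C)
    (hA : A' ⊆ B ∪ A) (hC : C' ⊆ B ∪ C) : FinIndep d A' B C' :=
  h.mono_cl hd ((Finset.coe_subset.2 hA).trans (hd.subset_cl _))
    ((Finset.coe_subset.2 hC).trans (hd.subset_cl _))

theorem trans {A B C E : Finset M} (h : FinIndep d A B C) (h' : FinIndep d A (B ∪ C) E) :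
    FinIndep d A B (C ∪ E) := by
  unfold FinIndep at *
  rw [← Finset.union_assoc, ← Finset.union_assoc] at *
  linarith

theorem base (hd : IsMonoSubmodular d) {A B C E : Finset M} (h : FinIndep d A B (C ∪ E)) :
    FinIndep d A (B ∪ C) E := by
  have hC : FinIndep d A B C := h.mono hd (by grind) (by grind)
  unfold FinIndep at *
  rw [← Finset.union_assoc, ← Finset.union_assoc] at *
  linarith

theorem subset_cl (hd : IsMonoSubmodular d) {A B C X : Finset M} (h : FinIndep d A B C)
    (hA : (X : Set M) ⊆ cl d (B ∪ A)) (hC : (X : Set M) ⊆ cl d (B ∪ C)) :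
    (X : Set M) ⊆ cl d B := by
  have := h.mono_cl hd hA hC
  rw [FinIndep, Finset.union_right_comm, Finset.union_self, Finset.union_comm X] at this
  exact hd.coe_subset_cl.2 (by linarith)

end FinIndep

end Closure

/-! ### Unbounded elements move almost maximally -/

section Fixer

variable {G M : Type*} [Group G] [MulAction G M] {d : Finset M → ℤ}

/-- `Aut(M/cl^d(X))` for a finite set `X`, with an arbitrary group acting in place of `Aut(M)`. -/
def fixer (G : Type*) {M : Type*} [Group G] [MulAction G M] (d : Finset M → ℤ) (X : Finset M) :
    Subgroup G :=
  fixingSubgroup G (cl d X)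

/-- `s` and `t` induce the same map on the `d`-closure of `X`. -/
def AgreeOn (d : Finset M → ℤ) (X : Finset M) (s t : G) : Prop :=
  ∀ a ∈ cl d X, s • a = t • a

theorem mem_fixer {X : Finset M} {k : G} : k ∈ fixer G d X ↔ ∀ a ∈ cl d X, k • a = a :=
  mem_fixingSubgroup_iff G

theorem fixer_le_fixer {X Y : Finset M} (h : cl d X ⊆ cl d Y) : fixer G d Y ≤ fixer G d X :=
  fixingSubgroup_antitone G M h

namespace AgreeOn

theorem symm {X : Finset M} {s t : G} (h : AgreeOn d X s t) : AgreeOn d X t s :=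
  fun a ha => (h a ha).symm

theorem trans {X : Finset M} {s t u : G} (h : AgreeOn d X s t) (h' : AgreeOn d X t u) :
    AgreeOn d X s u :=
  fun a ha => (h a ha).trans (h' a ha)

theorem mono {X Y : Finset M} {s t : G} (h : AgreeOn d X s t) (hY : cl d Y ⊆ cl d X) :
    AgreeOn d Y s t :=
  fun a ha => h a (hY ha)

theorem mul_left {X : Finset M} {s t : G} (h : AgreeOn d X s t) (u : G) :
    AgreeOn d X (u * s) (u * t) :=
  fun a ha => by rw [mul_smul, mul_smul, h a ha]

end AgreeOn

theorem agreeOn_iff_inv_mul_mem_fixer {X : Finset M} {s t : G} :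
    AgreeOn d X s t ↔ s⁻¹ * t ∈ fixer G d X := by
  simp only [AgreeOn, mem_fixer, mul_smul, inv_smul_eq_iff, eq_comm (a := t • _)]

theorem agreeOn_one_iff {X : Finset M} {k : G} : AgreeOn d X k 1 ↔ k ∈ fixer G d X := by
  simp only [AgreeOn, mem_fixer, one_smul]

namespace IsMonoSubmodular

theorem fixer_anti (hd : IsMonoSubmodular d) : Antitone (fixer G d) :=
  fun _ _ h => fixer_le_fixer (hd.cl_mono h)

theorem smul_finset_eq_of_agreeOn (hd : IsMonoSubmodular d) {X : Finset M} {s t : G}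
    (h : AgreeOn d X s t) : s • X = t • X :=
  Finset.image_congr fun x hx => h x (hd.subset_cl X hx)

theorem smul_finset_eq_self (hd : IsMonoSubmodular d) {X Y : Finset M} {k : G}
    (hk : k ∈ fixer G d X) (hY : Y ⊆ X) : k • Y = Y := by
  rw [hd.smul_finset_eq_of_agreeOn (agreeOn_one_iff.2 (hd.fixer_anti hY hk)), one_smul]

end IsMonoSubmodular

/-- A group acting on `M` by maps which preserve the monotone submodular function `d`. -/
structure IsInvariantDimension (G : Type*) {M : Type*} [Group G] [MulAction G M]
    (d : Finset M → ℤ) : Prop extends IsMonoSubmodular d where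
  smul_eq : ∀ (g : G) (X : Finset M), d (g • X) = d X

namespace IsInvariantDimension

theorem smul_mem_cl_smul (H : IsInvariantDimension G d) (g : G) {X : Finset M} {a : M} :
    g • a ∈ cl d (g • X) ↔ a ∈ cl d X := by
  rw [H.mem_cl, H.mem_cl, H.smul_eq, ← H.smul_eq g (insert a X), Finset.smul_finset_insert]

theorem coe_smul_subset_cl_smul (H : IsInvariantDimension G d) (g : G) {X Y : Finset M} :
    ((g • Y : Finset M) : Set M) ⊆ cl d (g • X) ↔ (Y : Set M) ⊆ cl d X := by
  rw [H.coe_subset_cl, H.coe_subset_cl, ← Finset.smul_finset_union, H.smul_eq, H.smul_eq]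

theorem finIndep_smul_iff (H : IsInvariantDimension G d) (g : G) {A B C : Finset M} :
    FinIndep d (g • A) (g • B) (g • C) ↔ FinIndep d A B C := by
  simp only [FinIndep, ← Finset.smul_finset_union, H.smul_eq]

theorem agreeOn_mul_right_iff (H : IsInvariantDimension G d) {X : Finset M} {s t u : G} :
    AgreeOn d X (s * u) (t * u) ↔ AgreeOn d (u • X) s t := by
  constructor
  · intro h a ha
    rw [← smul_inv_smul u a, H.smul_mem_cl_smul] at ha
    simpa only [mul_smul, smul_inv_smul] using h _ ha
  · intro h a ha
    rw [mul_smul, mul_smul]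
    exact h _ ((H.smul_mem_cl_smul u).2 ha)

theorem agreeOn_mul_iff (H : IsInvariantDimension G d) {X : Finset M} {k s : G} :
    AgreeOn d X (k * s) s ↔ k ∈ fixer G d (s • X) := by
  rw [← agreeOn_one_iff, ← H.agreeOn_mul_right_iff, one_mul]

theorem conj_mem_fixer (H : IsInvariantDimension G d) {X : Finset M} {k : G}
    (hk : k ∈ fixer G d X) (u : G) : u * k * u⁻¹ ∈ fixer G d (u • X) := by
  rw [← agreeOn_one_iff, ← H.agreeOn_mul_right_iff]
  simpa using (agreeOn_one_iff.2 hk).mul_left u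

end IsInvariantDimension

/-- An action preserving `d` and fixing the closure of the empty set pointwise, for which the
independence relation of `d` satisfies Existence and Stationarity. -/
structure IsIndepSystem (G : Type*) {M : Type*} [Group G] [MulAction G M]
    (d : Finset M → ℤ) : Prop extends IsInvariantDimension G d where
  fixer_empty : fixer G d ∅ = ⊤
  existence : ∀ A B C : Finset M, ∃ g ∈ fixer G d B, FinIndep d (g • A) B C
  stationary : ∀ A B C : Finset M, ∀ h ∈ fixer G d B, FinIndep d A B C →
    FinIndep d (h • A) B C → ∃ k ∈ fixer G d C, AgreeOn d (A ∪ B) k h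

end Fixer

section BasicOrbit

variable {G M : Type*} [Group G] [MulAction G M] {d : Finset M → ℤ}

/-- Over every finite set `B`, the set `C` has a conjugate which is independent from its image
under `g`. -/
def MovesAlmostMaximally (d : Finset M → ℤ) (g : G) : Prop :=
  ∀ B C : Finset M, ∃ k ∈ fixer G d B, FinIndep d (k • C) B (g • k • C)

/-- No finite set `E` is such that `g` maps the closure of `B` into itself for all finite
`B ⊇ E`. -/
def IsUnbounded (d : Finset M → ℤ) (g : G) : Prop :=
  ∀ E : Finset M, ∃ B : Finset M, E ⊆ B ∧ ¬ ((g • B : Finset M) : Set M) ⊆ cl d B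

theorem IsIndepSystem.isUnbounded_inv (H : IsIndepSystem G d) {g : G} (hg : IsUnbounded d g) :
    IsUnbounded d g⁻¹ := fun E => by
  obtain ⟨B, hEB, hB⟩ := hg E
  refine ⟨B, hEB, fun h => hB ?_⟩
  rw [H.coe_subset_cl] at h ⊢
  rw [← h, ← H.smul_eq g (B ∪ g⁻¹ • B), Finset.smul_finset_union, smul_inv_smul,
    Finset.union_comm]

/-- The orbit `orb(b/A)` for `A` the closure of a finite set. -/
abbrev orbitOver (G : Type*) {M : Type*} [Group G] [MulAction G M] (d : Finset M → ℤ)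
    (A : Finset M) (b : M) : Set M :=
  MulAction.orbit (fixer G d A) b

/-- The element `b` is basic over `cl^d(A)`, and the closure of `A` and the orbit of `b` over `A`
is everything. -/
structure IsBasicGenerator (G : Type*) {M : Type*} [Group G] [MulAction G M] (d : Finset M → ℤ)
    (A : Finset M) (b : M) : Prop where
  isBasic : IsBasic d b (cl d A)
  generates : dClosure d (cl d A ∪ orbitOver G d A b) = Set.univ

variable {A : Finset M} {b : M}

theorem mem_orbitOver {c : M} : c ∈ orbitOver G d A b ↔ ∃ k ∈ fixer G d A, k • b = c := by
  simp only [orbitOver, MulAction.mem_orbit_iff, Subtype.exists, Subgroup.mk_smul, exists_prop]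

theorem smul_mem_orbitOver {c : M} {k : G} (hk : k ∈ fixer G d A) (hc : c ∈ orbitOver G d A b) :
    k • c ∈ orbitOver G d A b :=
  MulAction.mem_orbit_of_mem_orbit (⟨k, hk⟩ : fixer G d A) hc

theorem coe_smul_subset_orbitOver {X : Finset M} {k : G} (hk : k ∈ fixer G d A)
    (hX : (X : Set M) ⊆ orbitOver G d A b) :
    ((k • X : Finset M) : Set M) ⊆ orbitOver G d A b := by
  rw [Finset.coe_smul_finset]
  rintro _ ⟨x, hx, rfl⟩
  exact smul_mem_orbitOver hk (hX hx)

theorem IsMonoSubmodular.dim_insert_of_isBasic (hd : IsMonoSubmodular d)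
    (hb : IsBasic d b (cl d A)) {C : Finset M} (hAC : A ⊆ C) (hbC : b ∉ cl d C) :
    d (insert b C) = d C + relDim d {b} (cl d A) := by
  have hge : relDim d {b} (cl d A) ≤ relDim d {b} (cl d C) :=
    not_lt.1 fun h => hbC (hb.2 _ ⟨C, rfl⟩ (hd.cl_mono hAC) h)
  rw [hd.relDim_eq _ (hd.subset_cl A) subset_rfl, ← Finset.insert_eq] at hge ⊢
  rw [hd.relDim_eq _ (hd.subset_cl C) subset_rfl, ← Finset.insert_eq] at hge
  have := hd.add_le_add_of_subset (U := insert b C) (Z := A) (X := insert b A) (Y := C)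
    (by grind) (by grind) hAC
  linarith

theorem IsMonoSubmodular.relDim_pos_of_isBasic (hd : IsMonoSubmodular d)
    (hb : IsBasic d b (cl d A)) : 0 < relDim d {b} (cl d A) := by
  have hne : d (insert b A) ≠ d A := fun h => hb.1 (hd.mem_cl.2 h)
  have hle := hd.mono (Finset.subset_insert b A)
  have := hd.dim_insert_of_isBasic hb subset_rfl hb.1
  omega

namespace IsInvariantDimension

theorem dim_insert_smul (H : IsInvariantDimension G d) (hb : IsBasic d b (cl d A)) (g : G) {c : M}
    (hc : c ∈ orbitOver G d A b) {C : Finset M} (hC : g • A ⊆ C) (hcC : g • c ∉ cl d C) :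
    d (insert (g • c) C) = d C + relDim d {b} (cl d A) := by
  obtain ⟨k, hk, rfl⟩ := mem_orbitOver.1 hc
  rw [smul_smul] at hcC ⊢
  have hC' : (g * k) • (g * k)⁻¹ • C = C := smul_inv_smul _ _
  rw [← hC', H.smul_mem_cl_smul] at hcC
  have hAC : A ⊆ (g * k)⁻¹ • C := by
    rwa [← Finset.smul_finset_subset_smul_finset_iff (a := g * k), hC', mul_smul,
      H.smul_finset_eq_self hk subset_rfl]
  have := H.dim_insert_of_isBasic hb hAC hcC
  rwa [← H.smul_eq (g * k), Finset.smul_finset_insert, hC', H.smul_eq] at this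

theorem dim_insert (H : IsInvariantDimension G d) (hb : IsBasic d b (cl d A)) {c : M}
    (hc : c ∈ orbitOver G d A b) {C : Finset M} (hC : A ⊆ C) (hcC : c ∉ cl d C) :
    d (insert c C) = d C + relDim d {b} (cl d A) := by
  simpa using H.dim_insert_smul hb 1 hc (by simpa) (by simpa)

theorem dim_union_smul_le (H : IsInvariantDimension G d) (hb : IsBasic d b (cl d A)) (g : G)
    {X C : Finset M} (hX : (X : Set M) ⊆ orbitOver G d A b) (hC : g • A ⊆ C) :
    d (C ∪ g • X) ≤ d C + relDim d {b} (cl d A) * X.card := by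
  induction X using Finset.induction_on with
  | empty => simp
  | insert x X hx ih =>
    rw [Finset.coe_insert, Set.insert_subset_iff] at hX
    rw [Finset.smul_finset_insert, Finset.union_insert, Finset.card_insert_of_notMem hx,
      Nat.cast_succ, mul_add_one]
    have hle := ih hX.2
    by_cases hxC : g • x ∈ cl d (C ∪ g • X)
    · linarith [H.mem_cl.1 hxC, H.relDim_pos_of_isBasic hb]
    · linarith [H.dim_insert_smul hb g hX.1 (hC.trans Finset.subset_union_left) hxC]

theorem dim_union_le (H : IsInvariantDimension G d) (hb : IsBasic d b (cl d A))
    {X C : Finset M} (hX : (X : Set M) ⊆ orbitOver G d A b) (hC : A ⊆ C) :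
    d (C ∪ X) ≤ d C + relDim d {b} (cl d A) * X.card := by
  simpa using H.dim_union_smul_le hb 1 hX (by simpa)

theorem exists_independent_subset (H : IsInvariantDimension G d) (hb : IsBasic d b (cl d A))
    {X E : Finset M} (hX : (X : Set M) ⊆ orbitOver G d A b) (hE : A ⊆ E) :
    ∃ Y ⊆ X, (X : Set M) ⊆ cl d (E ∪ Y) ∧ d (E ∪ Y) = d E + relDim d {b} (cl d A) * Y.card := by
  induction X using Finset.induction_on with
  | empty => exact ⟨∅, by simp⟩
  | insert x X _ ih =>
    rw [Finset.coe_insert, Set.insert_subset_iff] at hX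
    obtain ⟨Y, hYX, hXY, hdim⟩ := ih hX.2
    by_cases hx : x ∈ cl d (E ∪ Y)
    · exact ⟨Y, hYX.trans (Finset.subset_insert x X),
        by rw [Finset.coe_insert]; exact Set.insert_subset hx hXY, hdim⟩
    have hxY : x ∉ Y := fun h => hx (H.subset_cl _ (by simp [h]))
    refine ⟨insert x Y, Finset.insert_subset_insert x hYX, ?_, ?_⟩
    · rw [Finset.coe_insert]
      exact Set.insert_subset (H.subset_cl _ (by simp)) (hXY.trans (H.cl_mono (by grind)))
    · rw [Finset.union_insert, H.dim_insert hb hX.1 (hE.trans Finset.subset_union_left) hx, hdim,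
        Finset.card_insert_of_notMem hxY, Nat.cast_succ]
      ring

end IsInvariantDimension

namespace IsIndepSystem

theorem exists_smul_eq_over (H : IsIndepSystem G d) (hb : IsBasic d b (cl d A)) {c c' : M}
    (hc : c ∈ orbitOver G d A b) (hc' : c' ∈ orbitOver G d A b) {C : Finset M} (hC : A ⊆ C)
    (hcC : c ∉ cl d C) (hcC' : c' ∉ cl d C) : ∃ k ∈ fixer G d C, k • c = c' := by
  have hindep {e : M} (he : e ∈ orbitOver G d A b) (heC : e ∉ cl d C) : FinIndep d {e} A C := by
    have hC' := H.dim_insert hb he hC heC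
    have hA := H.dim_insert hb he subset_rfl fun h => heC (H.cl_mono hC h)
    rw [FinIndep, Finset.union_assoc, Finset.union_eq_right.2 hC, ← Finset.insert_eq,
      ← Finset.insert_eq]
    linarith
  obtain ⟨k, hk, rfl⟩ : ∃ k ∈ fixer G d A, k • c = c' :=
    mem_orbitOver.1 (by rwa [orbitOver, MulAction.orbit_eq_iff.2 hc])
  obtain ⟨l, hl, hlk⟩ := H.stationary {c} A C k hk (hindep hc hcC)
    (by rw [Finset.smul_finset_singleton]; exact hindep hc' hcC')
  exact ⟨l, hl, hlk c (H.subset_cl _ (by simp))⟩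

end IsIndepSystem

namespace IsBasicGenerator

theorem exists_subset_cl (hD : IsBasicGenerator G d A b) (hd : IsMonoSubmodular d)
    (Y : Finset M) :
    ∃ X : Finset M, (X : Set M) ⊆ orbitOver G d A b ∧ (Y : Set M) ⊆ cl d (A ∪ X) := by
  induction Y using Finset.induction_on with
  | empty => exact ⟨∅, by simp⟩
  | insert y Y _ ih =>
    obtain ⟨X, hX, hY⟩ := ih
    obtain ⟨Z, hZ, hy⟩ := hd.mem_dClosure_iff.1 (hD.generates ▸ Set.mem_univ y)
    set Z' := Z.filter (· ∈ orbitOver G d A b)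
    have hZZ' : (Z : Set M) ⊆ cl d (A ∪ Z') := fun z hz => by
      rcases hZ hz with h | h
      · exact hd.cl_mono Finset.subset_union_left h
      · exact hd.subset_cl _ (by simp [Z', Finset.mem_coe.1 hz, h])
    refine ⟨X ∪ Z', ?_, ?_⟩
    · rw [Finset.coe_union]
      exact Set.union_subset hX fun z hz => (Finset.mem_filter.1 hz).2
    · rw [Finset.coe_insert]
      exact Set.insert_subset (hd.cl_mono (by grind) (hd.cl_subset_cl_iff.2 hZZ' hy))
        (hY.trans (hd.cl_mono (by grind)))

theorem exists_smul_subset_cl (hD : IsBasicGenerator G d A b) (H : IsInvariantDimension G d)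
    {g : G} {E : Finset M} (hE : ∀ c ∈ orbitOver G d A b, g • c ∈ cl d (insert c E)) :
    ∃ F : Finset M, A ⊆ F ∧ ∀ X : Finset M, (X : Set M) ⊆ orbitOver G d A b →
      ((g • (F ∪ X) : Finset M) : Set M) ⊆ cl d (F ∪ X) := by
  obtain ⟨Y, hYD, hY⟩ := hD.exists_subset_cl H.toIsMonoSubmodular (E ∪ g • A)
  rw [Finset.coe_union, Set.union_subset_iff] at hY
  refine ⟨A ∪ Y, Finset.subset_union_left, fun X hX => ?_⟩
  have hg (Z : Finset M) (hZ : (Z : Set M) ⊆ orbitOver G d A b) (hZX : Z ⊆ A ∪ Y ∪ X) :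
      ((g • Z : Finset M) : Set M) ⊆ cl d (A ∪ Y ∪ X) := by
    rw [Finset.coe_smul_finset]
    rintro _ ⟨z, hz, rfl⟩
    refine H.cl_subset_cl_iff.2 ?_ (hE z (hZ hz))
    rw [Finset.coe_insert]
    exact Set.insert_subset (H.subset_cl _ (hZX hz))
      (hY.1.trans (H.cl_mono Finset.subset_union_left))
  rw [Finset.smul_finset_union, Finset.smul_finset_union, Finset.coe_union, Finset.coe_union]
  exact Set.union_subset (Set.union_subset (hY.2.trans (H.cl_mono Finset.subset_union_left))
    (hg Y hYD (by grind))) (hg X hX (by grind))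

/-- The closure of `B ⊇ F` is the intersection of the closures of two independent conjugates
`F ∪ X` and `F ∪ k • X` containing it, both of which are stabilised by `g`. -/
theorem smul_subset_cl (hD : IsBasicGenerator G d A b) (H : IsIndepSystem G d) {g : G}
    {F : Finset M} (hAF : A ⊆ F)
    (hF : ∀ X : Finset M, (X : Set M) ⊆ orbitOver G d A b →
      ((g • (F ∪ X) : Finset M) : Set M) ⊆ cl d (F ∪ X))
    {B : Finset M} (hFB : F ⊆ B) : ((g • B : Finset M) : Set M) ⊆ cl d B := by
  have hgB {X : Finset M} (hX : (X : Set M) ⊆ orbitOver G d A b)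
      (hBX : (B : Set M) ⊆ cl d (F ∪ X)) :
      ((g • B : Finset M) : Set M) ⊆ cl d (B ∪ (F ∪ X)) :=
    (((H.coe_smul_subset_cl_smul g).2 hBX).trans (H.cl_subset_cl_iff.2 (hF X hX))).trans
      (H.cl_mono Finset.subset_union_right)
  obtain ⟨X, hXD, hX⟩ := hD.exists_subset_cl H.toIsMonoSubmodular B
  have hBX : (B : Set M) ⊆ cl d (F ∪ X) :=
    hX.trans (H.cl_mono (Finset.union_subset_union_left hAF))
  obtain ⟨k, hk, hkX⟩ := H.existence (F ∪ X) B (F ∪ X)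
  have hBkX := (H.coe_smul_subset_cl_smul k).2 hBX
  rw [Finset.smul_finset_union, H.smul_finset_eq_self hk hFB,
    H.smul_finset_eq_self hk subset_rfl] at hBkX
  rw [Finset.smul_finset_union, H.smul_finset_eq_self hk hFB] at hkX
  exact hkX.subset_cl H.toIsMonoSubmodular
    (hgB (coe_smul_subset_orbitOver (H.fixer_anti (hAF.trans hFB) hk) hXD) hBkX) (hgB hXD hBX)

theorem exists_smul_notMem_cl (hD : IsBasicGenerator G d A b) (H : IsIndepSystem G d) {g : G}
    (hg : IsUnbounded d g) (E : Finset M) :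
    ∃ c ∈ orbitOver G d A b, c ∉ cl d E ∧ g • c ∉ cl d (insert c E) := by
  by_contra! hE
  have hE' : ∀ c ∈ orbitOver G d A b, g • c ∈ cl d (insert c (E ∪ g • E)) := fun c hc => by
    by_cases hcE : c ∈ cl d E
    · exact H.cl_mono (by grind) ((H.smul_mem_cl_smul g).2 hcE)
    · exact H.cl_mono (by grind) (hE c hc hcE)
  obtain ⟨F, hAF, hF⟩ := hD.exists_smul_subset_cl H.toIsInvariantDimension hE'
  obtain ⟨B, hFB, hB⟩ := hg F
  exact hB (hD.smul_subset_cl H hAF hF hFB)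

theorem exists_dim_union_smul (hD : IsBasicGenerator G d A b) (H : IsIndepSystem G d) {g : G}
    (hg : IsUnbounded d g) {E X : Finset M} (hAE : A ⊆ E) (hX : (X : Set M) ⊆ orbitOver G d A b)
    (hdim : d (E ∪ X) = d E + relDim d {b} (cl d A) * X.card) :
    ∃ k ∈ fixer G d E, d (E ∪ g • E ∪ k • X ∪ g • k • X) =
      d (E ∪ g • E) + 2 * relDim d {b} (cl d A) * X.card := by
  induction X using Finset.induction_on with
  | empty => exact ⟨1, one_mem _, by simp⟩
  | insert x X hx ih =>
    rw [Finset.coe_insert, Set.insert_subset_iff] at hX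
    rw [Finset.union_insert, Finset.card_insert_of_notMem hx, Nat.cast_succ] at hdim
    have hle := H.dim_union_le hD.isBasic hX.2 hAE
    have hxEX : x ∉ cl d (E ∪ X) := fun h => by
      linarith [H.mem_cl.1 h, H.relDim_pos_of_isBasic hD.isBasic]
    have hxEX' := H.dim_insert hD.isBasic hX.1 (hAE.trans Finset.subset_union_left) hxEX
    obtain ⟨k, hk, hkdim⟩ := ih hX.2 (by linarith)
    set P := E ∪ g • E ∪ k • X ∪ g • k • X with hP
    have hgAE : g • A ⊆ g • E := Finset.smul_finset_subset_smul_finset hAE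
    obtain ⟨c, hc, hcP, hgc⟩ := hD.exists_smul_notMem_cl H hg P
    have hkx : k • x ∉ cl d (E ∪ k • X) := by
      rwa [← H.smul_mem_cl_smul k, Finset.smul_finset_union, H.smul_finset_eq_self hk subset_rfl]
        at hxEX
    obtain ⟨l, hl, rfl⟩ := H.exists_smul_eq_over hD.isBasic
      (smul_mem_orbitOver (H.fixer_anti hAE hk) hX.1) hc (hAE.trans Finset.subset_union_left) hkx
      (fun h => hcP (H.cl_mono (by grind) h))
    refine ⟨l * k, mul_mem (H.fixer_anti Finset.subset_union_left hl) hk, ?_⟩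
    have hlk : (l * k) • insert x X = insert (l • k • x) (k • X) := by
      rw [mul_smul, Finset.smul_finset_insert, Finset.smul_finset_insert,
        H.smul_finset_eq_self hl Finset.subset_union_right]
    have hc' := H.dim_insert hD.isBasic hc (by grind) hcP
    have hgc' := H.dim_insert_smul hD.isBasic g hc (by grind) hgc
    have hinsert : E ∪ g • E ∪ (l * k) • insert x X ∪ g • (l * k) • insert x X =
        insert (g • l • k • x) (insert (l • k • x) P) := by
      rw [hlk, Finset.smul_finset_insert]
      grind
    rw [hinsert, Finset.card_insert_of_notMem hx, Nat.cast_succ]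
    linarith

theorem exists_finIndep_smul (hD : IsBasicGenerator G d A b) (H : IsIndepSystem G d) {g : G}
    (hg : IsUnbounded d g) {E : Finset M} (hAE : A ⊆ E) (C : Finset M) :
    ∃ k ∈ fixer G d E, FinIndep d (k • C) E (g • k • C) := by
  obtain ⟨X₀, hX₀D, hC⟩ := hD.exists_subset_cl H.toIsMonoSubmodular C
  obtain ⟨X, hXX₀, hX₀, hdim⟩ := H.exists_independent_subset hD.isBasic hX₀D hAE
  have hXD := (Finset.coe_subset.2 hXX₀).trans hX₀D
  have hCX : (C : Set M) ⊆ cl d (E ∪ X) := hC.trans <| H.cl_subset_cl_iff.2 <| by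
    rw [Finset.coe_union]
    exact Set.union_subset ((Finset.coe_subset.2 (hAE.trans Finset.subset_union_left)).trans
      (H.subset_cl _)) hX₀
  obtain ⟨k, hk, hkdim⟩ := hD.exists_dim_union_smul H hg hAE hXD hdim
  have hkXD := coe_smul_subset_orbitOver (H.fixer_anti hAE hk) hXD
  have hle := H.dim_union_le hD.isBasic hkXD hAE
  have hgle := H.dim_union_smul_le hD.isBasic g hkXD (C := E ∪ g • E)
    ((Finset.smul_finset_subset_smul_finset hAE).trans Finset.subset_union_right)
  rw [Finset.card_smul_finset] at hle hgle
  have hindep : FinIndep d (k • X) E (g • E ∪ g • k • X) := by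
    apply H.finIndep_of_le
    rw [← Finset.union_assoc, ← Finset.union_assoc, Finset.union_comm (k • X),
      Finset.union_right_comm E (k • X)]
    linarith
  have hkC := (H.coe_smul_subset_cl_smul k).2 hCX
  rw [Finset.smul_finset_union, H.smul_finset_eq_self hk subset_rfl] at hkC
  have hgkC := (H.coe_smul_subset_cl_smul g).2 hkC
  rw [Finset.smul_finset_union] at hgkC
  exact ⟨k, hk, hindep.mono_cl H.toIsMonoSubmodular hkC (hgkC.trans (H.cl_mono (by grind)))⟩

theorem movesAlmostMaximally (hD : IsBasicGenerator G d A b) (H : IsIndepSystem G d) {g : G}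
    (hg : IsUnbounded d g) : MovesAlmostMaximally d g := by
  intro B C
  obtain ⟨k, hk, hkC⟩ := H.existence C B (A ∪ B)
  obtain ⟨l, hl, hlC⟩ := hD.exists_finIndep_smul H hg Finset.subset_union_left (k • C)
  have hBl : B ⊆ A ∪ B := Finset.subset_union_right
  refine ⟨l * k, mul_mem (H.fixer_anti hBl hl) hk, ?_⟩
  rw [mul_smul]
  have hlkC := (H.finIndep_smul_iff l).2 hkC
  rw [H.smul_finset_eq_self hl hBl, H.smul_finset_eq_self hl subset_rfl] at hlkC
  rw [← Finset.union_eq_right.2 hBl] at hlC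
  exact (hlkC.trans hlC).mono H.toIsMonoSubmodular (by grind) (by grind)

end IsBasicGenerator

end BasicOrbit

/-! ### Products of four conjugates -/

section FourConjugates

variable {G M : Type*} [Group G] [MulAction G M] {d : Finset M → ℤ}

namespace IsInvariantDimension

theorem agreeOn_conj_mul (H : IsInvariantDimension G d) {X : Finset M} {g s a : G}
    (ha : a ∈ fixer G d (s • X ∪ (g * s) • X)) : AgreeOn d X (a⁻¹ * g * a * s) (g * s) := by
  have has : AgreeOn d X (a * s) s :=
    H.agreeOn_mul_iff.2 (H.fixer_anti Finset.subset_union_left ha)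
  have hags : AgreeOn d X (a⁻¹ * (g * s)) (g * s) :=
    H.agreeOn_mul_iff.2 (H.fixer_anti Finset.subset_union_right (inv_mem ha))
  simpa [mul_assoc] using (has.mul_left (a⁻¹ * g)).trans (by simpa [mul_assoc] using hags)

end IsInvariantDimension

namespace MovesAlmostMaximally

theorem conj (H : IsInvariantDimension G d) {g : G} (hg : MovesAlmostMaximally d g) (a : G) :
    MovesAlmostMaximally d (a⁻¹ * g * a) := by
  intro B C
  obtain ⟨k, hk, hC⟩ := hg (a • B) (a • C)
  refine ⟨a⁻¹ * k * a, by simpa using H.conj_mem_fixer hk a⁻¹, ?_⟩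
  rw [← H.finIndep_smul_iff a]
  simpa [smul_smul, mul_assoc] using hC

theorem inv_conj (H : IsInvariantDimension G d) {g : G} (hg : MovesAlmostMaximally d g⁻¹) (a : G) :
    MovesAlmostMaximally d (a⁻¹ * g * a)⁻¹ := by
  simpa [mul_assoc] using hg.conj H a

theorem exists_finIndep_union (H : IsIndepSystem G d) {g : G} (hg : MovesAlmostMaximally d g)
    {C X : Finset M} (hC : FinIndep d C X (g • X)) :
    ∃ k ∈ fixer G d (X ∪ g • X), FinIndep d (g • k • C) (g • X) (X ∪ k • C) := by
  have hd := H.toIsMonoSubmodular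
  set P := X ∪ g • X ∪ g⁻¹ • X
  have hXP : X ⊆ P := by grind
  have hXgX : X ∪ g • X ⊆ P := Finset.subset_union_left
  obtain ⟨l, hl, hlC⟩ := H.existence C (X ∪ g • X) P
  obtain ⟨m, hm, hmC⟩ := hg P (l • C)
  have hml := mul_mem (H.fixer_anti hXgX hm) hl
  refine ⟨m * l, hml, ?_⟩
  rw [smul_smul m l C] at hmC
  have hXz : FinIndep d ((m * l) • C) X (g • X) := by
    have := (H.finIndep_smul_iff (m * l)).2 hC
    rwa [H.smul_finset_eq_self hml Finset.subset_union_left,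
      H.smul_finset_eq_self hml Finset.subset_union_right] at this
  have hPz : FinIndep d ((m * l) • C) (X ∪ g • X) P := by
    have := (H.finIndep_smul_iff m).2 hlC
    rwa [H.smul_finset_eq_self hm subset_rfl, H.smul_finset_eq_self hm hXgX, smul_smul] at this
  have hXP' : FinIndep d ((m * l) • C) X P := (hXz.trans hPz).mono hd (by grind) (by grind)
  have hall : FinIndep d ((m * l) • C) X (P ∪ g • (m * l) • C) :=
    hXP'.trans (by rwa [Finset.union_eq_right.2 hXP])
  have hgX : FinIndep d (g • (m * l) • C) (g • X) X := by
    have := (H.finIndep_smul_iff g).2 (hXP'.mono hd (A' := (m * l) • C) (C' := g⁻¹ • X)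
      (by grind) (by grind))
    rwa [smul_inv_smul] at this
  refine hgX.trans ?_
  rw [Finset.union_comm]
  exact ((hall.mono hd (A' := (m * l) • C) (C' := g • X ∪ g • (m * l) • C)
    (by grind) (by grind)).base hd).symm

theorem exists_conj_finIndep (H : IsIndepSystem G d) {g : G} (hg : MovesAlmostMaximally d g)
    (B C W : Finset M) : ∃ a ∈ fixer G d B, FinIndep d ((a⁻¹ * g * a) • C) B W := by
  obtain ⟨k, hk, hkC⟩ := hg B C
  have hC : FinIndep d C B ((k⁻¹ * g * k) • C) := by
    rw [← H.finIndep_smul_iff k, H.smul_finset_eq_self hk subset_rfl]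
    simpa [smul_smul, mul_assoc] using hkC
  obtain ⟨u, hu, huW⟩ := H.existence ((k⁻¹ * g * k) • C) (B ∪ C) W
  have huB : u ∈ fixer G d B := H.fixer_anti Finset.subset_union_left hu
  have huC : u⁻¹ • C = C := H.smul_finset_eq_self (inv_mem hu) Finset.subset_union_right
  refine ⟨k * u⁻¹, mul_mem hk (inv_mem huB), ?_⟩
  have hconj : ((k * u⁻¹)⁻¹ * g * (k * u⁻¹)) • C = u • (k⁻¹ * g * k) • C := by
    conv_rhs => rw [← huC]
    simp only [smul_smul, mul_inv_rev, inv_inv, mul_assoc]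
  have huBC : FinIndep d (u • (k⁻¹ * g * k) • C) B C := by
    have := (H.finIndep_smul_iff u).2 hC.symm
    rwa [H.smul_finset_eq_self huB subset_rfl,
      H.smul_finset_eq_self hu Finset.subset_union_right] at this
  rw [hconj]
  exact (huBC.trans huW).mono H.toIsMonoSubmodular (by grind) (by grind)

/-- A conjugate of `g` moves the copy `s • C` to the copy `t • C`, provided the two copies are in
general position over their parts `s • X` and `t • X`. -/
theorem exists_conj_agreeOn (H : IsIndepSystem G d) {g : G} (hg : MovesAlmostMaximally d g)
    {X C : Finset M} {s t : G} (hst : AgreeOn d X (g * s) t)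
    (hs : FinIndep d (s • C) (s • X) (t • X))
    (ht : FinIndep d (t • C) (t • X) (s • X ∪ s • C)) :
    ∃ a ∈ fixer G d (s • X ∪ t • X), AgreeOn d C (a⁻¹ * g * a * s) t := by
  have hd := H.toIsMonoSubmodular
  have hgX : g • s • X = t • X := by rw [smul_smul, hd.smul_finset_eq_of_agreeOn hst]
  obtain ⟨k, hk, hkC⟩ := hg.exists_finIndep_union H (hgX.symm ▸ hs)
  rw [hgX] at hk hkC
  have hksX : k ∈ fixer G d (s • X) := H.fixer_anti Finset.subset_union_left hk
  have hktX : k ∈ fixer G d (t • X) := H.fixer_anti Finset.subset_union_right hk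
  have hkst : AgreeOn d X (g * k * s) (k * t) := by
    rw [mul_assoc]
    exact ((H.agreeOn_mul_iff.2 hksX).mul_left g).trans
      (hst.trans (H.agreeOn_mul_iff.2 hktX).symm)
  set h := g * k * s * (k * t)⁻¹
  have hht : h * (k * t) = g * k * s := inv_mul_cancel_right _ _
  have hhtX : h ∈ fixer G d (t • X) := by
    rwa [← hht, H.agreeOn_mul_iff, mul_smul, H.smul_finset_eq_self hktX subset_rfl] at hkst
  have hktC : FinIndep d ((k * t) • C) (t • X) (s • X ∪ k • s • C) := by
    have := (H.finIndep_smul_iff k).2 ht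
    rwa [Finset.smul_finset_union, H.smul_finset_eq_self hktX subset_rfl,
      H.smul_finset_eq_self hksX subset_rfl, smul_smul] at this
  obtain ⟨u, hu, huh⟩ := H.stationary ((k * t) • C) (t • X) (t • X ∪ (s • X ∪ k • s • C)) h hhtX
    (hktC.mono hd (by grind) (by grind)) (by
      rw [smul_smul, hht, mul_assoc, mul_smul, mul_smul]
      exact hkC.mono hd (by grind) (by grind))
  refine ⟨u * k, mul_mem (H.fixer_anti (by grind) hu) hk, ?_⟩
  have husC : AgreeOn d C (u * (k * s)) (k * s) := by
    have := H.fixer_anti (show (k * s) • C ⊆ _ by rw [mul_smul]; grind) hu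
    exact H.agreeOn_mul_iff.2 this
  have hutC : AgreeOn d C (u * (k * t)) (g * (k * s)) := by
    rw [← mul_assoc g, ← hht, H.agreeOn_mul_right_iff]
    exact huh.mono (H.cl_mono Finset.subset_union_left)
  have := (((husC.mul_left g).trans hutC.symm).mul_left (u * k)⁻¹)
  simpa [mul_assoc] using this

end MovesAlmostMaximally

namespace IsIndepSystem

theorem exists_conj_smul_finIndep (H : IsIndepSystem G d) (g : G) (Y W : Finset M) :
    ∃ c ∈ fixer G d Y, FinIndep d ((c⁻¹ * g * c) • Y) Y W := by
  obtain ⟨c, hc, hcW⟩ := H.existence (g • Y) Y W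
  refine ⟨c⁻¹, inv_mem hc, ?_⟩
  rwa [mul_smul, H.smul_finset_eq_self (inv_mem hc) subset_rfl, inv_inv, mul_smul]

/-- Along a path `s • X`, `(g * s) • X`, `(g' * g * s) • X` in general position, conjugates of `g`
and `g'` move the copy `s • C` to every sufficiently generic copy `t • C`. -/
theorem exists_two_conj_agreeOn (H : IsIndepSystem G d) {g g' : G}
    (hg : MovesAlmostMaximally d g) (hg' : MovesAlmostMaximally d g') {X : Finset M} {s : G}
    (hX : FinIndep d (s • X) ((g * s) • X) ((g' * (g * s)) • X)) (C : Finset M) :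
    ∃ a ∈ fixer G d ((g * s) • X), ∃ W : Finset M, ∀ t : G, AgreeOn d X t (g' * (g * s)) →
      FinIndep d (t • C) ((g' * (g * s)) • X) W →
        ∃ a' ∈ fixer G d ((g * s) • X),
          AgreeOn d C ((a'⁻¹ * g' * a') * ((a⁻¹ * g * a) * s)) t := by
  have hd := H.toIsMonoSubmodular
  obtain ⟨a, ha, haC⟩ := hg.exists_conj_finIndep H (s • X ∪ (g * s) • X) (s • C)
    ((g' * (g * s)) • X)
  have has : AgreeOn d X (a⁻¹ * g * a * s) (g * s) := H.agreeOn_conj_mul ha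
  have hasX := hd.smul_finset_eq_of_agreeOn has
  rw [smul_smul, Finset.union_comm] at haC
  have hC : FinIndep d ((a⁻¹ * g * a * s) • C) ((g * s) • X) ((g' * (g * s)) • X) :=
    (hX.symm.trans haC.symm).symm.mono hd (by grind) (by grind)
  refine ⟨a, H.fixer_anti Finset.subset_union_right ha,
    (g * s) • X ∪ (a⁻¹ * g * a * s) • C, fun t ht htW => ?_⟩
  rw [← hd.smul_finset_eq_of_agreeOn ht] at hC htW
  rw [← hasX] at hC htW
  obtain ⟨a', ha', hC'⟩ := hg'.exists_conj_agreeOn H ((has.mul_left g').trans ht.symm) hC htW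
  refine ⟨a', H.fixer_anti ?_ ha', by rwa [← mul_assoc (a'⁻¹ * g' * a')] at *⟩
  rw [hasX]
  exact Finset.subset_union_left

end IsIndepSystem

/-- The product of four conjugates `(h i)⁻¹ * g i * h i`. -/
def fourConj (g h : Fin 4 → G) : G :=
  ((h 3)⁻¹ * g 3 * h 3) * ((h 2)⁻¹ * g 2 * h 2) * (((h 1)⁻¹ * g 1 * h 1) * ((h 0)⁻¹ * g 0 * h 0))

namespace IsIndepSystem

/-- The two paths starting at `1` and at `v` meet in a common generic copy of `C`. -/
theorem exists_fourConj_agreeOn (H : IsIndepSystem G d) {g : Fin 4 → G}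
    (hg : ∀ i, MovesAlmostMaximally d (g i)) (hg' : ∀ i, MovesAlmostMaximally d (g i)⁻¹)
    {A X : Finset M} (hA : A ⊆ g 0 • X) (hA' : A ⊆ (g 2 * (g 1 * g 0)) • X)
    (hX : FinIndep d X (g 0 • X) ((g 1 * g 0) • X))
    (hX' : FinIndep d ((g 3 * (g 2 * (g 1 * g 0))) • X) ((g 2 * (g 1 * g 0)) • X)
      ((g 1 * g 0) • X)) {v : G} (hv : AgreeOn d X v (g 3 * (g 2 * (g 1 * g 0)))) (C : Finset M) :
    ∃ a : Fin 4 → G, (∀ i, a i ∈ fixer G d A) ∧ AgreeOn d C (fourConj g a) v := by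
  have hd := H.toIsMonoSubmodular
  have hv₃ : AgreeOn d X ((g 3)⁻¹ * v) (g 2 * (g 1 * g 0)) := by simpa using hv.mul_left (g 3)⁻¹
  have hv₂ : AgreeOn d X ((g 2)⁻¹ * ((g 3)⁻¹ * v)) (g 1 * g 0) := by
    simpa using hv₃.mul_left (g 2)⁻¹
  have hvX := hd.smul_finset_eq_of_agreeOn hv
  have hv₃X := hd.smul_finset_eq_of_agreeOn hv₃
  have hv₂X := hd.smul_finset_eq_of_agreeOn hv₂
  obtain ⟨a₀, ha₀, W, hW⟩ := H.exists_two_conj_agreeOn (hg 0) (hg 1) (X := X) (s := 1)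
    (by simpa using hX) C
  obtain ⟨a₃, ha₃, W', hW'⟩ := H.exists_two_conj_agreeOn (hg' 3) (hg' 2) (X := X) (s := v)
    (by rwa [hvX, hv₃X, hv₂X]) C
  simp only [mul_one] at ha₀ hW
  rw [hv₃X] at ha₃ hW'
  rw [hv₂X] at hW'
  obtain ⟨u, hu, huC⟩ := H.existence ((g 1 * g 0) • C) ((g 1 * g 0) • X) (W ∪ W')
  have ht : AgreeOn d X (u * (g 1 * g 0)) (g 1 * g 0) := H.agreeOn_mul_iff.2 hu
  rw [smul_smul] at huC
  obtain ⟨a₁, ha₁, hC₁⟩ := hW _ ht (huC.mono hd (by grind) (by grind))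
  obtain ⟨a₂, ha₂, hC₂⟩ := hW' _ (ht.trans hv₂.symm) (huC.mono hd (by grind) (by grind))
  refine ⟨![a₀, a₁, a₂, a₃], ?_, ?_⟩
  · rw [Fin.forall_fin_succ, Fin.forall_fin_succ, Fin.forall_fin_succ, Fin.forall_fin_one]
    exact ⟨H.fixer_anti hA ha₀, H.fixer_anti hA ha₁, H.fixer_anti hA' ha₂, H.fixer_anti hA' ha₃⟩
  · have := (hC₁.trans hC₂.symm).mul_left ((a₃⁻¹ * g 3 * a₃) * (a₂⁻¹ * g 2 * a₂))
    simpa [fourConj, mul_assoc] using this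

theorem exists_forall_fourConj_agreeOn (H : IsIndepSystem G d) {g : Fin 4 → G}
    (hg : ∀ i, MovesAlmostMaximally d (g i)) (hg' : ∀ i, MovesAlmostMaximally d (g i)⁻¹)
    (A : Finset M) :
    ∃ (v₀ : G) (X : Finset M), ∀ v, AgreeOn d X v v₀ → ∀ C,
      ∃ h : Fin 4 → G, (∀ i, h i ∈ fixer G d A) ∧ AgreeOn d C (fourConj g h) v := by
  set Y := g 1 • A ∪ (g 2)⁻¹ • A with hY
  have hA : A ⊆ (g 1)⁻¹ • Y := by rw [hY, Finset.smul_finset_union, inv_smul_smul]; grind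
  have hA' : A ⊆ g 2 • Y := by rw [hY, Finset.smul_finset_union, smul_inv_smul]; grind
  obtain ⟨c₀, hc₀, hX⟩ := H.exists_conj_smul_finIndep (g 0)⁻¹ ((g 1)⁻¹ • Y) Y
  obtain ⟨c₃, hc₃, hX'⟩ := H.exists_conj_smul_finIndep (g 3) (g 2 • Y) Y
  set c : Fin 4 → G := ![c₀, 1, 1, c₃] with hc
  have hcA : ∀ i, c i ∈ fixer G d A := by
    rw [Fin.forall_fin_succ, Fin.forall_fin_succ, Fin.forall_fin_succ, Fin.forall_fin_one]
    exact ⟨H.fixer_anti hA hc₀, one_mem _, one_mem _, H.fixer_anti hA' hc₃⟩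
  set f : Fin 4 → G := fun i => (c i)⁻¹ * g i * c i with hf
  have hf₁ : f 1 = g 1 := by simp [hf, hc]
  have hf₂ : f 2 = g 2 := by simp [hf, hc]
  have hf₀ : (c₀⁻¹ * (g 0)⁻¹ * c₀) = (f 0)⁻¹ := by simp [hf, hc, mul_assoc]
  set X := (f 0)⁻¹ • (g 1)⁻¹ • Y with hXY
  have hX₀ : f 0 • X = (g 1)⁻¹ • Y := by rw [hXY, smul_inv_smul]
  have hX₁ : (f 1 * f 0) • X = Y := by rw [mul_smul, hX₀, hf₁, smul_inv_smul]
  have hX₂ : (f 2 * (f 1 * f 0)) • X = g 2 • Y := by rw [mul_smul, hX₁, hf₂]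
  refine ⟨f 3 * (f 2 * (f 1 * f 0)), X, fun v hv C => ?_⟩
  obtain ⟨a, ha, haC⟩ := H.exists_fourConj_agreeOn (A := A)
    (fun i => (hg i).conj H.toIsInvariantDimension (c i))
    (fun i => (hg' i).inv_conj H.toIsInvariantDimension (c i)) (X := X) (by rwa [hX₀])
    (by rwa [hX₂]) (by rw [hX₀, hX₁, hXY, ← hf₀]; exact hX)
    (by rw [mul_smul, hX₂, hX₁]; exact hX') hv C
  refine ⟨c * a, fun i => mul_mem (hcA i) (ha i), ?_⟩
  simpa [fourConj, mul_assoc] using haC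

end IsIndepSystem

end FourConjugates

/-! ### Nearly feebly open maps -/

section NearlyFeeblyOpen

open Filter Metric

/-- A map is nearly feebly open if it maps nonempty open sets to somewhere dense sets. -/
def IsNearlyFeeblyOpen {X Y : Type*} [TopologicalSpace X] [TopologicalSpace Y] (φ : X → Y) : Prop :=
  ∀ U : Set X, IsOpen U → U.Nonempty → (interior (closure (φ '' U))).Nonempty

theorem IsNearlyFeeblyOpen.comp_homeomorph {X Y Z : Type*} [TopologicalSpace X]
    [TopologicalSpace Y] [TopologicalSpace Z] {φ : X → Y} (hφ : IsNearlyFeeblyOpen φ)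
    (e : Y ≃ₜ Z) : IsNearlyFeeblyOpen (e ∘ φ) := fun U hU hne => by
  rw [Set.image_comp, ← e.image_closure, ← e.image_interior]
  exact (hφ U hU hne).image e

variable {X X' Y : Type*}

/-- A nonempty open set `V` in which the image of the open set `U` is dense. -/
structure IsDenseImage [TopologicalSpace X] [TopologicalSpace Y] (φ : X → Y) (U : Set X)
    (V : Set Y) : Prop where
  isOpen : IsOpen U
  isOpen_image : IsOpen V
  nonempty : V.Nonempty
  subset_closure : V ⊆ closure (φ '' U)

theorem IsDenseImage.mono [TopologicalSpace X] [TopologicalSpace Y] {φ : X → Y} {U : Set X}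
    {V V' : Set Y} (h : IsDenseImage φ U V) (hV' : IsOpen V') (hne : V'.Nonempty) (hsub : V' ⊆ V) :
    IsDenseImage φ U V' :=
  ⟨h.isOpen, hV', hne, hsub.trans h.subset_closure⟩

theorem IsDenseImage.nonempty_left [TopologicalSpace X] [TopologicalSpace Y] {φ : X → Y}
    {U : Set X} {V : Set Y} (h : IsDenseImage φ U V) : U.Nonempty :=
  (closure_nonempty_iff.1 (h.nonempty.mono h.subset_closure)).of_image

/-- `V` is a set of radius at most `ε` whose closure lies in `U`. -/
structure ShrinksTo [PseudoMetricSpace X] (ε : ℝ) (U V : Set X) : Prop where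
  closure_subset : closure V ⊆ U
  subset_closedBall : ∃ x, V ⊆ closedBall x ε

theorem exists_forall_mem_of_shrinksTo [PseudoMetricSpace X] [CompleteSpace X] {ε : ℕ → ℝ}
    (hε : Tendsto ε atTop (𝓝 0)) {U : ℕ → Set X} (hne : ∀ n, (U n).Nonempty)
    (hU : ∀ n, ShrinksTo (ε n) (U n) (U (n + 1))) : ∃ x, ∀ n, x ∈ U n := by
  have hanti : Antitone U :=
    antitone_nat_of_succ_le fun n => subset_closure.trans (hU n).closure_subset
  have hbdd (n : ℕ) : Bornology.IsBounded (closure (U (n + 1))) := by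
    obtain ⟨x, hx⟩ := (hU n).subset_closedBall
    exact (isBounded_closedBall.subset hx).closure
  have hdiam (n : ℕ) : diam (closure (U (n + 1))) ≤ 2 * ε n := by
    obtain ⟨x, hx⟩ := (hU n).subset_closedBall
    have hball : closure (U (n + 1)) ⊆ closedBall x (ε n) := closure_minimal hx isClosed_closedBall
    obtain ⟨y, hy⟩ := hne (n + 1)
    exact (diam_mono hball isBounded_closedBall).trans
      (diam_closedBall (dist_nonneg.trans (hx hy)))
  obtain ⟨x, hx⟩ := nonempty_iInter_of_nonempty_biInter (s := fun n => closure (U (n + 1)))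
    (fun _ => isClosed_closure) hbdd
    (fun N => (hne (N + 1)).mono (Set.subset_iInter₂ fun n hn =>
      (hanti (Nat.succ_le_succ hn)).trans subset_closure))
    (squeeze_zero (fun _ => diam_nonneg) hdiam (by simpa using hε.const_mul 2))
  exact ⟨x, fun n => (hU n).closure_subset (Set.mem_iInter.1 hx n)⟩

theorem IsDenseImage.exists_shrinksTo [PseudoMetricSpace X] [TopologicalSpace Y] {φ : X → Y}
    (hφ : IsNearlyFeeblyOpen φ) (hc : Continuous φ) {U : Set X} {V : Set Y}
    (h : IsDenseImage φ U V) {ε : ℝ} (hε : 0 < ε) :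
    ∃ U₁, ∃ V₁ ⊆ V, ShrinksTo ε U U₁ ∧ IsDenseImage φ U₁ V₁ ∧ Set.MapsTo φ U₁ V := by
  obtain ⟨y, hy⟩ := h.nonempty
  obtain ⟨_, hxV, x, hxU, rfl⟩ := mem_closure_iff.1 (h.subset_closure hy) V h.isOpen_image hy
  obtain ⟨r, hr, hrU⟩ := nhds_basis_closedBall.mem_iff.1
    ((h.isOpen.inter (h.isOpen_image.preimage hc)).mem_nhds ⟨hxU, hxV⟩)
  set U₁ := ball x (min r ε)
  have hU₁ : closure U₁ ⊆ U ∩ φ ⁻¹' V :=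
    closure_ball_subset_closedBall.trans
      ((closedBall_subset_closedBall (min_le_left _ _)).trans hrU)
  have hU₁V : Set.MapsTo φ U₁ V := fun u hu => (hU₁ (_root_.subset_closure hu)).2
  obtain ⟨z, hz⟩ := hφ U₁ isOpen_ball (nonempty_ball.2 (lt_min hr hε))
  obtain ⟨_, hwV, w, hw, rfl⟩ := mem_closure_iff.1 (interior_subset hz) _ isOpen_interior hz
  exact ⟨U₁, interior (closure (φ '' U₁)) ∩ V, Set.inter_subset_right,
    ⟨hU₁.trans Set.inter_subset_left, x,
      ball_subset_closedBall.trans (closedBall_subset_closedBall (min_le_right _ _))⟩,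
    ⟨isOpen_ball, isOpen_interior.inter h.isOpen_image, ⟨φ w, hwV, hU₁V hw⟩,
      Set.inter_subset_left.trans interior_subset⟩, hU₁V⟩

theorem IsDenseImage.exists_shrinksTo₂ [PseudoMetricSpace X] [PseudoMetricSpace X']
    [PseudoMetricSpace Y] {φ : X → Y} {ψ : X' → Y} (hφ : IsNearlyFeeblyOpen φ)
    (hφc : Continuous φ) (hψ : IsNearlyFeeblyOpen ψ) (hψc : Continuous ψ) {U : Set X}
    {U' : Set X'} {V : Set Y} (h : IsDenseImage φ U V) (h' : IsDenseImage ψ U' V) {ε : ℝ}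
    (hε : 0 < ε) :
    ∃ U₁ U₁' V₁, IsDenseImage φ U₁ V₁ ∧ IsDenseImage ψ U₁' V₁ ∧ ShrinksTo ε U U₁ ∧
      ShrinksTo ε U' U₁' ∧ ∀ x ∈ U₁, ∀ x' ∈ U₁', dist (φ x) (ψ x') ≤ ε := by
  obtain ⟨y, hy⟩ := h.nonempty
  have hW : IsOpen (V ∩ ball y (ε / 2)) := h.isOpen_image.inter isOpen_ball
  have hne : (V ∩ ball y (ε / 2)).Nonempty := ⟨y, hy, mem_ball_self (half_pos hε)⟩
  obtain ⟨U₁, V₁, hV₁, hU₁, hφ₁, hmaps⟩ :=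
    (h.mono hW hne Set.inter_subset_left).exists_shrinksTo hφ hφc hε
  obtain ⟨U₁', V₂, hV₂, hU₁', hψ₁, hmaps'⟩ :=
    (h'.mono hφ₁.isOpen_image hφ₁.nonempty
      (hV₁.trans Set.inter_subset_left)).exists_shrinksTo hψ hψc hε
  refine ⟨U₁, U₁', V₂, hφ₁.mono hψ₁.isOpen_image hψ₁.nonempty hV₂, hψ₁, hU₁, hU₁',
    fun x hx x' hx' => ?_⟩
  calc dist (φ x) (ψ x') ≤ dist (φ x) y + dist (ψ x') y := dist_triangle_right _ _ _
    _ ≤ ε / 2 + ε / 2 :=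
      add_le_add (mem_ball.1 (hmaps hx).2).le (mem_ball.1 (hV₁ (hmaps' hx')).2).le
    _ = ε := add_halves ε

theorem exists_eq_of_isNearlyFeeblyOpen [TopologicalSpace X] [TopologicalSpace X']
    [TopologicalSpace Y] [TopologicalSpace.IsCompletelyPseudoMetrizableSpace X]
    [TopologicalSpace.IsCompletelyPseudoMetrizableSpace X'] [TopologicalSpace.MetrizableSpace Y]
    [Nonempty X'] {φ : X → Y} {ψ : X' → Y} (hφ : IsNearlyFeeblyOpen φ) (hφc : Continuous φ)
    (hφd : DenseRange φ) (hψ : IsNearlyFeeblyOpen ψ) (hψc : Continuous ψ) :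
    ∃ x x', φ x = ψ x' := by
  let := TopologicalSpace.upgradeIsCompletelyPseudoMetrizable X
  let := TopologicalSpace.upgradeIsCompletelyPseudoMetrizable X'
  let := TopologicalSpace.metrizableSpaceMetric Y
  let ε (n : ℕ) : ℝ := (1 / 2) ^ n
  have hε : Tendsto ε atTop (𝓝 0) :=
    tendsto_pow_atTop_nhds_zero_of_lt_one (by norm_num) (by norm_num)
  let P (S : Set X × Set X') : Prop := ∃ V, IsDenseImage φ S.1 V ∧ IsDenseImage ψ S.2 V
  have hstep (n : ℕ) (S : Set X × Set X') (hS : P S) : ∃ T, P T ∧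
      ShrinksTo (ε n) S.1 T.1 ∧ ShrinksTo (ε n) S.2 T.2 ∧
      ∀ x ∈ T.1, ∀ x' ∈ T.2, dist (φ x) (ψ x') ≤ ε n := by
    obtain ⟨V, h, h'⟩ := hS
    obtain ⟨U, U', V₁, hU, hU', hshrink⟩ :=
      h.exists_shrinksTo₂ hφ hφc hψ hψc h' (show 0 < ε n by positivity)
    exact ⟨(U, U'), ⟨V₁, hU, hU'⟩, hshrink⟩
  choose! next hP hshrink hshrink' hdist using hstep
  let S (n : ℕ) : Set X × Set X' := n.rec (Set.univ, Set.univ) next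
  have hS (n : ℕ) : P (S n) := by
    induction n with
    | zero =>
      have hV := hψ Set.univ isOpen_univ Set.univ_nonempty
      exact ⟨_, ⟨isOpen_univ, isOpen_interior, hV, by simp [S, hφd.closure_range]⟩,
        ⟨isOpen_univ, isOpen_interior, hV, interior_subset⟩⟩
    | succ n ih => exact hP n _ ih
  obtain ⟨x, hx⟩ := exists_forall_mem_of_shrinksTo hε
    (fun n => let ⟨_, h, _⟩ := hS n; h.nonempty_left) fun n => hshrink n _ (hS n)
  obtain ⟨x', hx'⟩ := exists_forall_mem_of_shrinksTo hε
    (fun n => let ⟨_, _, h⟩ := hS n; h.nonempty_left) fun n => hshrink' n _ (hS n)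
  exact ⟨x, x', dist_le_zero.1 <| ge_of_tendsto' hε fun n =>
    hdist n _ (hS n) x (hx (n + 1)) x' (hx' (n + 1))⟩

end NearlyFeeblyOpen

/-! ### The topology defined by the closures of finite sets -/

section Topology

open TopologicalSpace Topology

/-- The left cosets of `g` and `g⁻¹` modulo each of the subgroups `U i`. -/
def cosetPair {G ι : Type*} [Group G] (U : ι → Subgroup G) (g : G) (i : ι) :
    (G ⧸ U i) × (G ⧸ U i) :=
  (g, (g⁻¹ : G))

section CosetPair

variable {G ι : Type*} [Group G] {U : ι → Subgroup G}

theorem isInducing_cosetPair [TopologicalSpace G] [IsTopologicalGroup G]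
    [∀ i, DiscreteTopology (G ⧸ U i)]
    (hU : (𝓝 (1 : G)).HasBasis (fun _ => True) fun i => (U i : Set G)) :
    IsInducing (cosetPair U) := by
  refine isInducing_iff_nhds.2 fun s => le_antisymm ?_ ?_
  · refine (Continuous.tendsto ?_ s).le_comap
    exact continuous_pi fun i => (QuotientGroup.continuous_mk.prodMk
      (QuotientGroup.continuous_mk.comp continuous_inv))
  · rw [← map_mul_left_nhds_one s, (hU.map _).ge_iff]
    intro i _
    refine Filter.mem_comap.2 ⟨(· i) ⁻¹' {cosetPair U s i},
      ((isOpen_discrete {cosetPair U s i}).preimage (continuous_apply i)).mem_nhds rfl,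
      fun t ht => ?_⟩
    have hst : (s : G ⧸ U i) = t := (congrArg Prod.fst ht).symm
    exact ⟨s⁻¹ * t, QuotientGroup.eq.1 hst, mul_inv_cancel_left s t⟩

theorem isClosed_range_cosetPair [TopologicalSpace G] [∀ i, DiscreteTopology (G ⧸ U i)]
    (hc : ∀ x, (∀ I : Finset ι, ∃ g, ∀ i ∈ I, cosetPair U g i = x i) →
      x ∈ Set.range (cosetPair U)) : IsClosed (Set.range (cosetPair U)) := by
  refine isClosed_of_closure_subset fun x hx => hc x fun I => ?_
  have hI : (I : Set ι).pi (fun i => {x i}) ∈ 𝓝 x :=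
    set_pi_mem_nhds I.finite_toSet fun i _ => by simp
  obtain ⟨_, hg, g, rfl⟩ := mem_closure_iff_nhds.1 hx _ hI
  exact ⟨g, hg⟩

end CosetPair

variable {G M : Type*} [Group G] [MulAction G M] {d : Finset M → ℤ}

/-- The pointwise stabilisers of the closures of finite sets form a basis of neighbourhoods
of the identity. -/
def HasFixerBasis (G : Type*) {M : Type*} [Group G] [MulAction G M] [TopologicalSpace G]
    (d : Finset M → ℤ) : Prop :=
  (𝓝 (1 : G)).HasBasis (fun _ => True) fun X : Finset M => (fixer G d X : Set G)

/-- The group topology with the fixers as a basis of neighbourhoods of the identity. -/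
abbrev IsInvariantDimension.groupFilterBasis (H : IsInvariantDimension G d) :
    GroupFilterBasis G where
  sets := Set.range fun X => (fixer G d X : Set G)
  nonempty := Set.range_nonempty _
  inter_sets := by
    rintro _ _ ⟨X, rfl⟩ ⟨Y, rfl⟩
    exact ⟨_, ⟨X ∪ Y, rfl⟩, fun k hk => ⟨H.fixer_anti Finset.subset_union_left hk,
      H.fixer_anti Finset.subset_union_right hk⟩⟩
  one' := by
    rintro _ ⟨X, rfl⟩
    exact one_mem _
  mul' := by
    rintro _ ⟨X, rfl⟩
    exact ⟨_, ⟨X, rfl⟩, (coe_mul_coe _).le⟩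
  inv' := by
    rintro _ ⟨X, rfl⟩
    exact ⟨_, ⟨X, rfl⟩, fun k hk => inv_mem hk⟩
  conj' := by
    rintro u _ ⟨X, rfl⟩
    exact ⟨_, ⟨u⁻¹ • X, rfl⟩, fun k hk => by simpa using H.conj_mem_fixer hk u⟩

theorem IsInvariantDimension.exists_hasFixerBasis (H : IsInvariantDimension G d) :
    ∃ _ : TopologicalSpace G, IsTopologicalGroup G ∧ HasFixerBasis G d := by
  refine ⟨H.groupFilterBasis.topology, inferInstance, ?_⟩
  have := H.groupFilterBasis.nhds_one_hasBasis
  refine this.to_hasBasis ?_ fun X _ => ⟨_, ⟨X, rfl⟩, subset_rfl⟩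
  rintro _ ⟨X, rfl⟩
  exact ⟨X, trivial, subset_rfl⟩

theorem cosetPair_fixer_eq_iff {X : Finset M} {s : G} {x : G × G} :
    cosetPair (fixer G d) s X = (↑x.1, ↑x.2) ↔ AgreeOn d X s x.1 ∧ AgreeOn d X s⁻¹ x.2 := by
  simp only [cosetPair, Prod.mk.injEq, QuotientGroup.eq, ← agreeOn_iff_inv_mul_mem_fixer]

/-- The permutations of `M` induced by `G` form a closed subset of the symmetric group. -/
def IsClosedAction (G M : Type*) [Group G] [MulAction G M] : Prop :=
  ∀ p q : M → M, (∀ X : Finset M, ∃ g : G, ∀ x ∈ X, g • x = p x ∧ g⁻¹ • x = q x) →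
    ∃ g : G, ∀ m, g • m = p m ∧ g⁻¹ • m = q m

theorem IsClosedAction.mem_range_cosetPair (hd : IsMonoSubmodular d) (hGM : IsClosedAction G M)
    {x : ∀ X, (G ⧸ fixer G d X) × (G ⧸ fixer G d X)}
    (hx : ∀ I : Finset (Finset M), ∃ g, ∀ X ∈ I, cosetPair (fixer G d) g X = x X) :
    x ∈ Set.range (cosetPair (fixer G d)) := by
  have hsurj (X : Finset M) : ∃ y : G × G, (↑y.1, ↑y.2) = x X :=
    (QuotientGroup.mk_surjective.prodMap QuotientGroup.mk_surjective) (x X)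
  choose y hy using hsurj
  simp only [← hy, cosetPair_fixer_eq_iff] at hx
  have hmem (m : M) : m ∈ cl d {m} := hd.subset_cl _ (by simp)
  obtain ⟨g, hg⟩ := hGM (fun m => (y {m}).1 • m) (fun m => (y {m}).2 • m) fun X => by
    obtain ⟨g, hg⟩ := hx (X.image fun m => {m})
    refine ⟨g, fun m hm => ?_⟩
    obtain ⟨h, h'⟩ := hg {m} (Finset.mem_image_of_mem _ hm)
    exact ⟨h m (hmem m), h' m (hmem m)⟩
  refine ⟨g, funext fun X => ?_⟩
  rw [← hy, cosetPair_fixer_eq_iff]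
  have hX (a : M) (ha : a ∈ cl d X) : g • a = (y X).1 • a ∧ g⁻¹ • a = (y X).2 • a := by
    obtain ⟨k, hk⟩ := hx {X, {a}}
    obtain ⟨h, h'⟩ := hk X (by simp)
    obtain ⟨ha₁, ha₂⟩ := hk {a} (by simp)
    rw [(hg a).1, (hg a).2, ← ha₁ a (hmem a), ← ha₂ a (hmem a)]
    exact ⟨h a ha, h' a ha⟩
  exact ⟨fun a ha => (hX a ha).1, fun a ha => (hX a ha).2⟩

variable [TopologicalSpace G] [IsTopologicalGroup G]

theorem HasFixerBasis.nhds (hG : HasFixerBasis G d) (s : G) :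
    (𝓝 s).HasBasis (fun _ => True) fun X : Finset M => {t | AgreeOn d X t s} := by
  have := hG.map (s * ·)
  rw [map_mul_left_nhds_one] at this
  refine this.congr (fun _ => Iff.rfl) fun X _ => Set.ext fun t => ?_
  rw [Set.image_mul_left, Set.mem_preimage, SetLike.mem_coe, ← agreeOn_iff_inv_mul_mem_fixer]
  exact ⟨AgreeOn.symm, AgreeOn.symm⟩

theorem HasFixerBasis.mem_closure_iff (hG : HasFixerBasis G d) {S : Set G} {s : G} :
    s ∈ closure S ↔ ∀ X : Finset M, ∃ t ∈ S, AgreeOn d X t s := by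
  simp [mem_closure_iff_nhds_basis (hG.nhds s)]

theorem HasFixerBasis.isCompletelyMetrizableSpace [Countable M] [FaithfulSMul G M]
    (hd : IsMonoSubmodular d) (hGM : IsClosedAction G M) (hG : HasFixerBasis G d) :
    IsCompletelyMetrizableSpace G := by
  have (X : Finset M) : DiscreteTopology (G ⧸ fixer G d X) :=
    QuotientGroup.discreteTopology (Subgroup.isOpen_of_mem_nhds _ (hG.mem_of_mem trivial))
  have hinj : Function.Injective (cosetPair (fixer G d)) := fun s t hst => by
    refine FaithfulSMul.eq_of_smul_eq_smul (α := M) fun m => ?_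
    have := congrArg Prod.fst (congrFun hst {m})
    exact agreeOn_iff_inv_mul_mem_fixer.2 (QuotientGroup.eq.1 this) m (hd.subset_cl _ (by simp))
  exact (IsClosedEmbedding.mk ⟨isInducing_cosetPair hG, hinj⟩
    (isClosed_range_cosetPair fun _ => hGM.mem_range_cosetPair hd)).IsCompletelyMetrizableSpace

end Topology

section Products

open TopologicalSpace

variable {G M : Type*} [Group G] [MulAction G M] {d : Finset M → ℤ}

/-- The conjugation action of `G` on itself is topologically transitive. -/
theorem IsIndepSystem.exists_conj_agreeOn_agreeOn (H : IsIndepSystem G d) (v w : G)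
    (X Y : Finset M) : ∃ c u : G, AgreeOn d X (c⁻¹ * u * c) v ∧ AgreeOn d Y u w := by
  have hd := H.toIsMonoSubmodular
  have hempty (k : G) : k ∈ fixer G d ∅ := H.fixer_empty ▸ Subgroup.mem_top k
  obtain ⟨c, -, hc⟩ := H.existence (X ∪ v • X) ∅ (Y ∪ w • Y)
  rw [Finset.smul_finset_union] at hc
  have hX : FinIndep d (w • c • X) ∅ (w • Y) := by
    have := (H.finIndep_smul_iff w).2 (hc.mono hd (A' := c • X) (C' := Y) (by grind) (by grind))
    rwa [Finset.smul_finset_empty] at this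
  set h := c * v * c⁻¹ * w⁻¹
  have hwX : h • w • c • X = c • v • X := by simp [h, smul_smul, mul_assoc]
  obtain ⟨k, hk, hkh⟩ := H.stationary (w • c • X) ∅ (w • Y) h (hempty h) hX <| by
    rw [hwX]
    exact hc.mono hd (by grind) (by grind)
  refine ⟨c, k * w, ?_, H.agreeOn_mul_iff.2 hk⟩
  rw [Finset.union_empty, smul_smul, ← H.agreeOn_mul_right_iff] at hkh
  simpa [h, mul_assoc] using hkh.mul_left c⁻¹

theorem fourConj_const_mul_right (g : G) (h : Fin 4 → G) (c : G) :
    fourConj (fun _ => g) (fun i => h i * c) = c⁻¹ * fourConj (fun _ => g) h * c := by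
  simp [fourConj, mul_assoc]

theorem continuous_fourConj [TopologicalSpace G] [IsTopologicalGroup G] (g : Fin 4 → G) :
    Continuous (fourConj g) := by
  unfold fourConj
  fun_prop

namespace HasFixerBasis

variable [TopologicalSpace G] [IsTopologicalGroup G]

theorem isNearlyFeeblyOpen_fourConj (hG : HasFixerBasis G d) (H : IsIndepSystem G d) {g : G}
    (hg : MovesAlmostMaximally d g) (hg' : MovesAlmostMaximally d g⁻¹) :
    IsNearlyFeeblyOpen (fourConj fun _ => g) := by
  have H' := H.toIsInvariantDimension
  rintro U hU ⟨h, hh⟩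
  have hUh : U ∈ 𝓝 h := hU.mem_nhds hh
  obtain ⟨⟨I, A⟩, -, hAU⟩ :=
    (nhds_pi (a := h) ▸ Filter.hasBasis_pi fun i => hG.nhds (h i)).mem_iff.1 hUh
  obtain ⟨v, X, hX⟩ := H.exists_forall_fourConj_agreeOn (g := fun i => (h i)⁻¹ * g * h i)
    (fun i => hg.conj H' (h i)) (fun i => hg'.inv_conj H' (h i)) (Finset.univ.biUnion A)
  refine ⟨v, mem_interior_iff_mem_nhds.2 ((hG.nhds v).mem_iff.2
    ⟨X, trivial, fun u hu => hG.mem_closure_iff.2 fun C => ?_⟩)⟩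
  obtain ⟨a, ha, haC⟩ := hX u hu C
  refine ⟨_, ⟨h * a, hAU fun i _ => ?_, rfl⟩, by simpa [fourConj, mul_assoc] using haC⟩
  have hai : a i ∈ fixer G d (A i) :=
    H.fixer_anti (Finset.subset_biUnion_of_mem A (Finset.mem_univ i)) (ha i)
  simpa using (agreeOn_one_iff.2 hai).mul_left (h i)

theorem denseRange_fourConj (hG : HasFixerBasis G d) (H : IsIndepSystem G d) {g : G}
    (hg : MovesAlmostMaximally d g) (hg' : MovesAlmostMaximally d g⁻¹) :
    DenseRange (fourConj fun _ => g) := by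
  obtain ⟨v, X, hX⟩ := H.exists_forall_fourConj_agreeOn (fun _ => hg) (fun _ => hg') ∅
  refine fun w => hG.mem_closure_iff.2 fun Y => ?_
  obtain ⟨c, u, huX, huY⟩ := H.exists_conj_agreeOn_agreeOn v w X Y
  obtain ⟨h, -, hh⟩ := hX _ huX (c⁻¹ • Y)
  refine ⟨_, ⟨fun i => h i * c⁻¹, rfl⟩, .trans ?_ huY⟩
  have := (H.agreeOn_mul_right_iff.2 hh).mul_left c
  rw [fourConj_const_mul_right, inv_inv, mul_assoc]
  simpa only [mul_assoc, mul_inv_cancel_left, mul_inv_cancel, mul_one] using this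

end HasFixerBasis

theorem IsIndepSystem.exists_fourConj_eq_mul_fourConj [Countable M] [FaithfulSMul G M]
    (H : IsIndepSystem G d) (hGM : IsClosedAction G M) {g : G}
    (hg : MovesAlmostMaximally d g) (hg' : MovesAlmostMaximally d g⁻¹) (f : G) :
    ∃ h k : Fin 4 → G, fourConj (fun _ => g) h = f * fourConj (fun _ => g) k := by
  obtain ⟨_, _, hG⟩ := H.exists_hasFixerBasis
  have := hG.isCompletelyMetrizableSpace H.toIsMonoSubmodular hGM
  have hopen := hG.isNearlyFeeblyOpen_fourConj H hg hg'
  exact exists_eq_of_isNearlyFeeblyOpen hopen (continuous_fourConj _)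
    (hG.denseRange_fourConj H hg hg') (hopen.comp_homeomorph (Homeomorph.mulLeft f))
    ((continuous_fourConj _).const_mul f)

end Products

section ConjugateLists

variable {G : Type*} [Group G]

theorem exists_list_isConj_of_fourConj_eq {g f : G} {h k : Fin 4 → G}
    (hf : fourConj (fun _ => g) h = f * fourConj (fun _ => g) k) :
    ∃ l : List G, l.length = 8 ∧ (∀ x ∈ l, IsConj g x ∨ IsConj g⁻¹ x) ∧ l.prod = f := by
  have hconj (a b : G) : IsConj a (b⁻¹ * a * b) := isConj_iff.2 ⟨b⁻¹, by rw [inv_inv]⟩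
  refine ⟨[3, 2, 1, 0].map (fun i => (h i)⁻¹ * g * h i) ++
    [0, 1, 2, 3].map (fun i => (k i)⁻¹ * g⁻¹ * k i), rfl, fun x hx => ?_, ?_⟩
  · simp only [List.mem_append, List.mem_map] at hx
    exact hx.imp (fun ⟨i, _, hi⟩ => hi ▸ hconj g (h i)) fun ⟨i, _, hi⟩ => hi ▸ hconj g⁻¹ (k i)
  · rw [eq_mul_inv_of_mul_eq hf.symm]
    simp [fourConj, mul_assoc]

theorem exists_list_isConj_length_add {g : G} {l : List G}
    (hl : ∀ x ∈ l, IsConj g x ∨ IsConj g⁻¹ x) (n : ℕ) :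
    ∃ l' : List G, l'.length = l.length + 2 * n ∧ (∀ x ∈ l', IsConj g x ∨ IsConj g⁻¹ x) ∧
      l'.prod = l.prod := by
  induction n with
  | zero => exact ⟨l, rfl, hl, rfl⟩
  | succ n ih =>
    obtain ⟨l', hlen, hl', hprod⟩ := ih
    refine ⟨g :: g⁻¹ :: l', by simp only [List.length_cons]; lia, ?_, by simp [hprod]⟩
    rw [List.forall_mem_cons, List.forall_mem_cons]
    exact ⟨.inl (.refl g), .inr (.refl g⁻¹), hl'⟩

end ConjugateLists

/-! ### Automorphism groups -/

section Automorphisms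

variable {L : FirstOrder.Language} {M : Type*} [L.Structure M] {d : Finset M → ℤ}

/-- Automorphisms act on the structure by evaluation. -/
instance autMulAction (L : FirstOrder.Language) (M : Type*) [L.Structure M] :
    MulAction (M ≃[L] M) M where
  smul f m := f m
  one_smul _ := rfl
  mul_smul _ _ _ := rfl

instance autFaithfulSMul (L : FirstOrder.Language) (M : Type*) [L.Structure M] :
    FaithfulSMul (M ≃[L] M) M :=
  ⟨fun h => FirstOrder.Language.Equiv.ext h⟩

theorem autFix_anti {Y Z : Set M} (h : Y ⊆ Z) : autFix L Z ≤ autFix L Y :=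
  fun _ hf y hy => hf y (h hy)

theorem isClosedAction_autFix (Z : Set M) : IsClosedAction (autFix L Z) M := by
  intro p q hpq
  have hagree (X : Finset M) : ∃ f ∈ autFix L Z, ∀ x ∈ X, f x = p x ∧ f.symm x = q x := by
    obtain ⟨f, hf⟩ := hpq X
    exact ⟨f, f.2, hf⟩
  have hqp (m : M) : q (p m) = m := by
    obtain ⟨f, -, hf⟩ := hagree {m, p m}
    rw [← (hf (p m) (by simp)).2, ← (hf m (by simp)).1, f.symm_apply_apply]
  have hpq' (m : M) : p (q m) = m := by
    obtain ⟨f, -, hf⟩ := hagree {m, q m}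
    rw [← (hf (q m) (by simp)).1, ← (hf m (by simp)).2, f.apply_symm_apply]
  have htuple {n : ℕ} (x : Fin n → M) (X : Finset M) :
      ∃ f : M ≃[L] M, p ∘ x = f ∘ x ∧ ∀ m ∈ X, p m = f m := by
    obtain ⟨f, -, hf⟩ := hagree (Finset.univ.image x ∪ X)
    exact ⟨f, funext fun i => (hf (x i) (by simp)).1.symm,
      fun m hm => (hf m (Finset.mem_union_right _ hm)).1.symm⟩
  let e : M ≃[L] M :=
    { toFun := p
      invFun := q
      left_inv := hqp
      right_inv := hpq'
      map_fun' := fun F x => by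
        obtain ⟨f, hfx, hfF⟩ := htuple x {FirstOrder.Language.Structure.funMap F x}
        rw [hfx, hfF _ (Finset.mem_singleton_self _), FirstOrder.Language.Equiv.map_fun]
      map_rel' := fun R x => by
        obtain ⟨f, hfx, -⟩ := htuple x ∅
        rw [hfx, FirstOrder.Language.Equiv.map_rel] }
  refine ⟨⟨e, fun z hz => ?_⟩, fun m => ⟨rfl, rfl⟩⟩
  obtain ⟨f, hfZ, hf⟩ := hagree {z}
  exact (hf z (by simp)).1.symm.trans (hfZ z hz)

theorem mem_fixer_autFix {Z : Set M} {X : Finset M} {g : autFix L Z} :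
    g ∈ fixer (autFix L Z) d X ↔ (g : M ≃[L] M) ∈ autFix L (cl d X) :=
  mem_fixer

theorem IsMonoSubmodular.dClosure_empty_subset_cl (hd : IsMonoSubmodular d) (X : Finset M) :
    dClosure d (∅ : Set M) ⊆ cl d X := by
  rw [← Finset.coe_empty]
  exact hd.cl_mono (Finset.empty_subset X)

/-- `Aut(M/cl^d(∅))`. -/
abbrev autFixClEmpty (L : FirstOrder.Language) {M : Type*} [L.Structure M] (d : Finset M → ℤ) :
    Subgroup (M ≃[L] M) :=
  autFix L (dClosure d (∅ : Set M))

namespace IsDimensionFunction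

theorem isInvariantDimension (hd : IsDimensionFunction L d) :
    IsInvariantDimension (M ≃[L] M) d where
  mono X Y h := by simpa only [Finset.union_eq_right.2 h] using hd.mono X Y
  submod X Y := by linarith [hd.submodular X Y]
  smul_eq := hd.invariant

theorem image_cl (hd : IsDimensionFunction L d) (f : M ≃[L] M) (X : Finset M) :
    f '' cl d X = cl d (f • X) := by
  ext a
  rw [← smul_inv_smul f a, hd.isInvariantDimension.smul_mem_cl_smul]
  exact f.injective.mem_set_image

theorem exists_mem_fixer_eq (hd : IsDimensionFunction L d) {X : Finset M} {f : M ≃[L] M}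
    (hf : f ∈ autFix L (cl d X)) : ∃ k ∈ fixer (autFixClEmpty L d) d X, (k : M ≃[L] M) = f :=
  ⟨⟨f, autFix_anti (hd.isInvariantDimension.dClosure_empty_subset_cl X) hf⟩,
    mem_fixer_autFix.2 hf, rfl⟩

theorem isIndepSystem (hd : IsDimensionFunction L d) (hex : Existence L d)
    (hstat : Stationary L d) : IsIndepSystem (autFixClEmpty L d) d where
  toIsMonoSubmodular := hd.isInvariantDimension.toIsMonoSubmodular
  smul_eq g := hd.invariant g
  fixer_empty := by
    refine (Subgroup.eq_top_iff' _).2 fun g => mem_fixer_autFix.2 ?_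
    rw [cl, Finset.coe_empty]
    exact g.2
  existence A B C := by
    have H := hd.isInvariantDimension
    obtain ⟨g, hg, hind⟩ := hex _ ⟨A, rfl⟩ _ ⟨B, rfl⟩ _ ⟨C, rfl⟩
    obtain ⟨k, hk, rfl⟩ := hd.exists_mem_fixer_eq hg
    refine ⟨k, hk, ?_⟩
    rwa [hd.image_cl, H.indep_cl_iff] at hind
  stationary A B C h hB hA hA' := by
    have H := hd.isInvariantDimension
    have hAB : h • (A ∪ B) = h • A ∪ B := by
      rw [Finset.smul_finset_union, H.smul_finset_eq_self hB subset_rfl]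
    obtain ⟨k, hk, hkC⟩ := hstat (cl d (A ∪ B)) ⟨_, rfl⟩ (cl d (h • (A ∪ B))) ⟨_, rfl⟩
      (cl d B) ⟨_, rfl⟩ (cl d C) ⟨_, rfl⟩ (H.cl_mono Finset.subset_union_right)
      (H.cl_mono (hAB ▸ Finset.subset_union_right))
      (H.indep_cl_iff.2 (hA.mono H.toIsMonoSubmodular (by grind) (by grind)))
      (H.indep_cl_iff.2 (hAB ▸ hA'.mono H.toIsMonoSubmodular (by grind) (by grind)))
      h (hd.image_cl _ _) (mem_fixer_autFix.1 hB)
    obtain ⟨l, hl, rfl⟩ := hd.exists_mem_fixer_eq hkC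
    exact ⟨l, hl, hk⟩

theorem orbitOver_eq_orb (hd : IsDimensionFunction L d) (A : Finset M) (b : M) :
    orbitOver (autFixClEmpty L d) d A b = orb L b (cl d A) := by
  ext c
  rw [mem_orbitOver]
  constructor
  · rintro ⟨k, hk, rfl⟩
    exact ⟨k, mem_fixer_autFix.1 hk, rfl⟩
  · rintro ⟨f, hf, rfl⟩
    obtain ⟨k, hk, rfl⟩ := hd.exists_mem_fixer_eq hf
    exact ⟨k, hk, rfl⟩

theorem isUnbounded (hd : IsDimensionFunction L d) {g : autFixClEmpty L d}
    (hg : ¬ IsClBounded d (g : M ≃[L] M)) : IsUnbounded d g := by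
  have H := hd.isInvariantDimension
  intro E
  by_contra! hE
  refine hg ⟨_, ⟨E, rfl⟩, ?_⟩
  rintro _ ⟨B, rfl⟩ hEB
  have hBE : cl d (B ∪ E) = cl d B := by
    refine (H.cl_subset_cl_iff.2 ?_).antisymm (H.cl_mono Finset.subset_union_left)
    rw [Finset.coe_union]
    exact Set.union_subset (H.subset_cl B) ((H.subset_cl E).trans hEB)
  have hgBE : (((g : M ≃[L] M) • (B ∪ E) : Finset M) : Set M) ⊆ cl d (B ∪ E) :=
    hE _ Finset.subset_union_right
  change _ '' cl d B = cl d B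
  rw [← hBE, hd.image_cl]
  refine (H.cl_subset_cl_iff.2 hgBE).antisymm (H.cl_subset_cl_iff.2 ?_)
  rw [H.coe_subset_cl] at hgBE ⊢
  rw [Finset.union_comm, hgBE, H.smul_eq]

end IsDimensionFunction

end Automorphisms

end DimIndep

theorem corollary3p13_general {L : FirstOrder.Language} {M : Type*} [L.Structure M] [Countable M]
    (d : Finset M → ℤ) (hd : DimIndep.IsDimensionFunction L d) (hex : DimIndep.Existence L d)
    (hstat : DimIndep.Stationary L d)
    (A : Set M) (hA : A ∈ DimIndep.closures d)
    (D : Set M) (hD : DimIndep.IsBasicOrbit L d D A)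
    (hAD : DimIndep.dClosure d (A ∪ D) = Set.univ)
    (g : DimIndep.autFix L (DimIndep.dClosure d (∅ : Set M)))
    (hg : ¬ DimIndep.IsClBounded d (g : L.Equiv M M))
    (f : DimIndep.autFix L (DimIndep.dClosure d (∅ : Set M))) :
    ∃ l : List (DimIndep.autFix L (DimIndep.dClosure d (∅ : Set M))),
      l.length = 8 ∧ (∀ x ∈ l, IsConj g x ∨ IsConj g⁻¹ x) ∧ l.prod = f := by
  obtain ⟨A, rfl⟩ := hA
  obtain ⟨b, hb, rfl⟩ := hD
  have H := hd.isIndepSystem hex hstat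
  have hbasic : DimIndep.IsBasicGenerator (DimIndep.autFixClEmpty L d) d A b :=
    ⟨hb, by rwa [hd.orbitOver_eq_orb]⟩
  have hunb := hd.isUnbounded hg
  obtain ⟨h, k, hf⟩ := H.exists_fourConj_eq_mul_fourConj (DimIndep.isClosedAction_autFix _)
    (hbasic.movesAlmostMaximally H hunb) (hbasic.movesAlmostMaximally H (H.isUnbounded_inv hunb)) f
  exact DimIndep.exists_list_isConj_of_fourConj_eq hf

theorem corollary3p13 {L : FirstOrder.Language} {M : Type*} [L.Structure M] [Countable M]
    (d : Finset M → ℤ) (hd : DimIndep.StandingAssumption L d)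
    (hstat : DimIndep.Stationary L d)
    (A : Set M) (hA : A ∈ DimIndep.closures d)
    (D : Set M) (hD : DimIndep.IsBasicOrbit L d D A)
    (hAD : DimIndep.dClosure d (A ∪ D) = Set.univ)
    (g : DimIndep.autFix L (DimIndep.dClosure d (∅ : Set M)))
    (hg : ¬ DimIndep.IsClBounded d (g : L.Equiv M M))
    (f : DimIndep.autFix L (DimIndep.dClosure d (∅ : Set M))) :
    ∃ l : List (DimIndep.autFix L (DimIndep.dClosure d (∅ : Set M))),
      l.length = 96 ∧ (∀ x ∈ l, IsConj g x ∨ IsConj g⁻¹ x) ∧ l.prod = f := by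
  obtain ⟨l, hlen, hl, rfl⟩ := corollary3p13_general d hd.isDimensionFunction hd.existence hstat
    A hA D hD hAD g hg f
  simpa only [hlen] using DimIndep.exists_list_isConj_length_add hl 44
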